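/- All lattices are nonempty. For a lattice $L$, $\operatorname{Con} L$ is the lattice of congruences of $L$ ordered by inclusion, $J(L)$ is the poset of nonzero join-irreducible elements of $L$, and $M(L)$ is the poset of non-unit meet-irreducible elements of $L$. A \emph{slim semimodular lattice} is a finite (upper) semimodular lattice $L$ such that $J(L)$ is the union of two (possibly empty) chains. A \emph{slim rectangular lattice} is a slim semimodular lattice $L$ such that $J(L)\cap M(L)$ consists of exactly two elements and these two elements are complementary (their meet is $0$ and their join is $1$). A finite distributive lattice $D$ is \emph{CSPS-representable} (respectively, \emph{CSR-representable}) if $D\cong\operatorname{Con} L$ for some slim semimodular (respectively, slim rectangular) lattice $L$. A finite, possibly empty poset $P$ is \emph{JCSPS-representable} (respectively, \emph{JCSR-representable}) if $P\cong J(\operatorname{Con} L)$ for some slim semimodular (respectively, slim rectangular) lattice $L$. Lattice filters are nonempty; an order filter of a poset is a (possibly empty) up-set with the inherited order. (A) Let $D$ be a CSPS-representable finite distributive lattice. Then every filter of $D$ (regarded as a lattice) is CSPS-representable, and every filter of $D$ with at least three elements is CSR-representable. (B) Let $P$ be a finite, possibly empty poset. If $P$ is JCSPS-representable, then every order filter of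 $P$ is JCSPS-representable, and every order filter of $P$ with at least two elements is JCSR-representable. In particular, if $P$ is JCSR-representable, then every order filter of $P$ with at least two elements is JCSR-representable. -/

import Mathlib

/-! ### Congruence lattices -/

namespace LatticeCon

variable {L : Type*} [Lattice L]

theorem toSetoid_inj : Function.Injective (toSetoid : LatticeCon L → Setoid L) := by
  rintro ⟨s, hs, hs'⟩ ⟨t, ht, ht'⟩ h
  obtain rfl : s = t := h
  rfl

/-- Congruences are ordered by inclusion: `c ≤ d` iff `c.r x y` implies `d.r x y`. -/
instance instPartialOrder : PartialOrder (LatticeCon L) :=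
  PartialOrder.lift toSetoid toSetoid_inj

theorem le_iff {c d : LatticeCon L} : c ≤ d ↔ ∀ ⦃x y : L⦄, c.r x y → d.r x y :=
  Iff.rfl

/-- The infimum of a set of congruences is their intersection. -/
instance instInfSet : InfSet (LatticeCon L) where
  sInf S :=
    { r := fun x y => ∀ c ∈ S, c.r x y
      iseqv :=
        { refl := fun x c _ => c.iseqv.refl x
          symm := fun h c hc => c.iseqv.symm (h c hc)
          trans := fun h h' c hc => c.iseqv.trans (h c hc) (h' c hc) }
      inf := fun h h' c hc => c.inf (h c hc) (h' c hc)
      sup := fun h h' c hc => c.sup (h c hc) (h' c hc) }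

/-- The congruence lattice `Con L` of a lattice `L`, ordered by inclusion. -/
instance instCompleteLattice : CompleteLattice (LatticeCon L) :=
  completeLatticeOfInf _ fun _ =>
    ⟨fun c hc _ _ h => h c hc, fun _ hd _ _ h _ hc => hd hc h⟩

end LatticeCon

/-! ### Filters of a distributive lattice as lattices -/

/-- A filter of a distributive lattice is a distributive lattice under the inherited operations. -/
instance Order.PFilter.instDistribLattice {D : Type*} [DistribLattice D] (F : Order.PFilter D) :
    DistribLattice F :=
  Subtype.distribLattice (P := fun x => x ∈ F)
    (fun _ _ hx _ => Order.PFilter.mem_of_le le_sup_left hx)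
    (fun _ _ hx hy => Order.PFilter.inf_mem hx hy)

/-! ### Slim semimodular and slim rectangular lattices -/

/-- The poset `J(L)` of nonzero join-irreducible elements of `L`, with the order inherited from `L`
(`SupIrred` excludes minimal elements). -/
abbrev JirPoset (L : Type*) [Lattice L] : Type _ := {x : L // SupIrred x}

/-- A slim lattice: a finite (nonempty) lattice whose set of nonzero join-irreducible elements is
the union of two (possibly empty) chains. -/
structure IsSlimLattice (L : Type*) [Lattice L] : Prop where
  finite : Finite L
  nonempty : Nonempty L
  jir_eq_union : ∃ C C' : Set L,
    IsChain (· ≤ ·) C ∧ IsChain (· ≤ ·) C' ∧ {x : L | SupIrred x} = C ∪ C'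

/-- A slim semimodular lattice. Mathlib's `IsUpperModularLattice` is (upper) semimodularity:
`a ⊓ b ⋖ a` implies `b ⋖ a ⊔ b`. -/
structure IsSlimSemimodularLattice (L : Type*) [Lattice L] : Prop extends IsSlimLattice L where
  semimodular : IsUpperModularLattice L

/-- A doubly irreducible element: nonzero join-irreducible and non-unit meet-irreducible. -/
def IsDoublyIrred {L : Type*} [Lattice L] (x : L) : Prop :=
  SupIrred x ∧ InfIrred x

/-- A slim rectangular lattice: a slim semimodular lattice that has exactly two doubly irreducible
elements, and these two elements are complementary (their meet is `0` and their join is `1`). -/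
structure IsSlimRectangularLattice (L : Type*) [Lattice L] : Prop
    extends IsSlimSemimodularLattice L where
  exists_corners : ∃ a b : L, a ≠ b ∧ (∀ x : L, IsDoublyIrred x ↔ x = a ∨ x = b) ∧
    IsBot (a ⊓ b) ∧ IsTop (a ⊔ b)

/-! ### Representability

As slim lattices are finite, letting `L` range over lattices in `Type` loses no generality. An order
isomorphism between lattices is the same as a lattice isomorphism. -/

/-- `D` is CSPS-representable: `D ≅ Con L` for some slim semimodular lattice `L`. -/
def CSPSRepresentable (D : Type*) [DistribLattice D] : Prop :=
  ∃ (L : Type) (_ : Lattice L), IsSlimSemimodularLattice L ∧ Nonempty (D ≃o LatticeCon L)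

/-- `D` is CSR-representable: `D ≅ Con L` for some slim rectangular lattice `L`. -/
def CSRRepresentable (D : Type*) [DistribLattice D] : Prop :=
  ∃ (L : Type) (_ : Lattice L), IsSlimRectangularLattice L ∧ Nonempty (D ≃o LatticeCon L)

/-- `P` is JCSPS-representable: `P ≅ J(Con L)` for some slim semimodular lattice `L`. -/
def JCSPSRepresentable (P : Type*) [PartialOrder P] : Prop :=
  ∃ (L : Type) (_ : Lattice L), IsSlimSemimodularLattice L ∧
    Nonempty (P ≃o JirPoset (LatticeCon L))

/-- `P` is JCSR-representable: `P ≅ J(Con L)` for some slim rectangular lattice `L`. -/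
def JCSRRepresentable (P : Type*) [PartialOrder P] : Prop :=
  ∃ (L : Type) (_ : Lattice L), IsSlimRectangularLattice L ∧
    Nonempty (P ≃o JirPoset (LatticeCon L))

/-! ### Quadrant lattices

Two injective coordinates `x y : E → ℕ` turn a finite type `E` into a planar point configuration.
Its quadrants, ordered by reverse inclusion, form a slim semimodular lattice, and all such
lattices arise in this way. -/

/-! Meet-irreducible elements of a slim semimodular lattice `L` become points of the plane. Extend
the two chains covering `J(L)` to maximal chains; the coordinates of `m` count the elements of these
chains below `m`. Both coordinates are injective (`flagHeight_injective`), and `u ↦ {m | u ≤ m}`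
identifies `L` with the quadrants of this configuration (`exists_orderIso`).

A congruence is determined by its labels, the points whose prime interval it collapses, and the
label sets are exactly the sets closed under `QuadPred` (`conOrderIso`). Only a point with others
both to its upper left and to its lower right has predecessors: the horizontally nearest one to the
upper left and the vertically nearest one to the lower right.

A filter of `Con L` consists of the closed sets containing a fixed closed set `T`. The complement of
`T` contains all predecessors of its points, so deleting `T` leaves `QuadPred` unchanged on the rest
(`leftPred_restrict_iff`), and the filter is the congruence lattice of the smaller configuration. If
at least two points remain, moving the upper left boundary far up and the lower right boundary far
right makes the quadrant lattice rectangular and preserves `QuadPred`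
(`exists_isSlimRectangularLattice`). For (B), an order filter of `J(D)` is `J` of a principal filter
of `D` (`exists_ici_jirPoset_orderIso`). -/

section Quadrants

variable {E : Type*}

/-- The smallest quadrant `{e | i ≤ x e ∧ j ≤ y e}` that contains `S`. -/
def quadHull (x y : E → ℕ) (S : Set E) : Set E :=
  {e | (∃ s ∈ S, x s ≤ x e) ∧ ∃ s ∈ S, y s ≤ y e}

theorem subset_quadHull (x y : E → ℕ) (S : Set E) : S ⊆ quadHull x y S :=
  fun e he => ⟨⟨e, he, le_rfl⟩, ⟨e, he, le_rfl⟩⟩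

theorem quadHull_mono (x y : E → ℕ) {S T : Set E} (h : S ⊆ T) :
    quadHull x y S ⊆ quadHull x y T := by
  rintro e ⟨⟨s, hs, hs'⟩, ⟨t, ht, ht'⟩⟩
  exact ⟨⟨s, h hs, hs'⟩, ⟨t, h ht, ht'⟩⟩

theorem quadHull_quadHull (x y : E → ℕ) (S : Set E) :
    quadHull x y (quadHull x y S) ⊆ quadHull x y S := by
  rintro e ⟨⟨s, ⟨⟨s', hs', h1⟩, -⟩, h2⟩, ⟨t, ⟨-, ⟨t', ht', h3⟩⟩, h4⟩⟩
  exact ⟨⟨s', hs', h1.trans h2⟩, ⟨t', ht', h3.trans h4⟩⟩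

theorem quadHull_swap (x y : E → ℕ) (S : Set E) : quadHull y x S = quadHull x y S := by
  ext e
  exact and_comm

theorem quadHull_inter_subset {x y : E → ℕ} {S T : Set E} (hS : quadHull x y S ⊆ S)
    (hT : quadHull x y T ⊆ T) : quadHull x y (S ∩ T) ⊆ S ∩ T :=
  fun _ he => ⟨hS (quadHull_mono x y Set.inter_subset_left he),
    hT (quadHull_mono x y Set.inter_subset_right he)⟩

/-- The lattice of quadrants of a point configuration, ordered by reverse inclusion. -/
@[ext]
structure QuadLattice (x y : E → ℕ) where
  /-- The points of the quadrant. -/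
  carrier : Set E
  hull_subset : quadHull x y carrier ⊆ carrier

namespace QuadLattice

variable {x y : E → ℕ}

instance : Lattice (QuadLattice x y) where
  le u v := v.carrier ⊆ u.carrier
  le_refl u := Set.Subset.refl _
  le_trans u v w h h' := Set.Subset.trans h' h
  le_antisymm u v h h' := QuadLattice.ext (Set.Subset.antisymm h' h)
  sup u v := ⟨u.carrier ∩ v.carrier, quadHull_inter_subset u.hull_subset v.hull_subset⟩
  le_sup_left _ _ := Set.inter_subset_left
  le_sup_right _ _ := Set.inter_subset_right
  sup_le _ _ _ h h' := Set.subset_inter h h'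
  inf u v := ⟨quadHull x y (u.carrier ∪ v.carrier), quadHull_quadHull x y _⟩
  inf_le_left _ _ := Set.subset_union_left.trans (subset_quadHull x y _)
  inf_le_right _ _ := Set.subset_union_right.trans (subset_quadHull x y _)
  le_inf u _ _ h h' := (quadHull_mono x y (Set.union_subset h h')).trans u.hull_subset

theorem le_iff {u v : QuadLattice x y} : u ≤ v ↔ v.carrier ⊆ u.carrier := Iff.rfl

theorem carrier_inf (u v : QuadLattice x y) :
    (u ⊓ v).carrier = quadHull x y (u.carrier ∪ v.carrier) := rfl

theorem carrier_injective :
    Function.Injective (carrier : QuadLattice x y → Set E) := fun _ _ => QuadLattice.ext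

instance [Finite E] : Finite (QuadLattice x y) := Finite.of_injective _ carrier_injective

theorem lt_iff {u v : QuadLattice x y} : u < v ↔ v.carrier ⊂ u.carrier := by
  rw [lt_iff_le_not_ge, le_iff, le_iff, Set.ssubset_def]

/-- The least quadrant containing `e`. -/
def quad (x y : E → ℕ) (e : E) : QuadLattice x y where
  carrier := {f | x e ≤ x f ∧ y e ≤ y f}
  hull_subset := by
    rintro f ⟨⟨s, hs, hs'⟩, ⟨t, ht, ht'⟩⟩
    exact ⟨hs.1.trans hs', ht.2.trans ht'⟩

/-- The quadrant of all points strictly above `e` in both coordinates. -/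
def openQuad (x y : E → ℕ) (e : E) : QuadLattice x y where
  carrier := {f | x e < x f ∧ y e < y f}
  hull_subset := by
    rintro f ⟨⟨s, hs, hs'⟩, ⟨t, ht, ht'⟩⟩
    exact ⟨hs.1.trans_le hs', ht.2.trans_le ht'⟩

theorem quad_le_openQuad (e : E) : quad x y e ≤ openQuad x y e :=
  fun _ hf => ⟨hf.1.le, hf.2.le⟩

theorem mem_of_le {u : QuadLattice x y} {e f : E} (he : e ∈ u.carrier) (hx : x e ≤ x f)
    (hy : y e ≤ y f) : f ∈ u.carrier :=
  u.hull_subset ⟨⟨e, he, hx⟩, ⟨e, he, hy⟩⟩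

theorem le_quad_iff {u : QuadLattice x y} {e : E} : u ≤ quad x y e ↔ e ∈ u.carrier :=
  ⟨fun h => h ⟨le_rfl, le_rfl⟩, fun h _ hf => mem_of_le h hf.1 hf.2⟩

theorem mem_openQuad_of_mem_quad (hx : Function.Injective x) (hy : Function.Injective y) {e f : E}
    (h : f ∈ (quad x y e).carrier) (hne : f ≠ e) : f ∈ (openQuad x y e).carrier :=
  ⟨lt_of_le_of_ne h.1 fun h' => hne (hx h').symm, lt_of_le_of_ne h.2 fun h' => hne (hy h').symm⟩

/-- The anti-exchange property of the quadrant closure. -/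
theorem anti_exchange (hx : Function.Injective x) (hy : Function.Injective y)
    {u : QuadLattice x y} {e f : E} (hf : f ∉ u.carrier) (hne : f ≠ e)
    (h : f ∈ quadHull x y (insert e u.carrier)) : e ∉ quadHull x y (insert f u.carrier) := by
  rintro ⟨⟨s, hs, hs'⟩, ⟨t, ht, ht'⟩⟩
  obtain ⟨⟨p, hp, hp'⟩, ⟨q, hq, hq'⟩⟩ := h
  -- A point outside a quadrant is strictly left of all its points or strictly below them all. In
  -- that coordinate only `e` can bound `f` and only `f` can bound `e`, so the two would agree
  -- there.
  have key : (∀ r ∈ u.carrier, x f < x r) ∨ ∀ r ∈ u.carrier, y f < y r := by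
    by_contra! hcon
    obtain ⟨⟨r, hr, hr'⟩, ⟨r2, hr2, hr2'⟩⟩ := hcon
    exact hf (u.hull_subset ⟨⟨r, hr, hr'⟩, ⟨r2, hr2, hr2'⟩⟩)
  have hxne : x f ≠ x e := fun h => hne (hx h)
  have hyne : y f ≠ y e := fun h => hne (hy h)
  rcases key with key | key
  · have h1 : x e ≤ x f := by
      rcases hp with rfl | hp
      · exact hp'
      · exact absurd (key p hp) (not_lt.2 hp')
    rcases hs with rfl | hs
    · omega
    · have := key s hs
      omega
  · have h1 : y e ≤ y f := by
      rcases hq with rfl | hq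
      · exact hq'
      · exact absurd (key q hq) (not_lt.2 hq')
    rcases ht with rfl | ht
    · omega
    · have := key t ht
      omega

/-- Between two quadrants there is one that has just one point more than the smaller one. -/
theorem exists_insert [Finite E] (hx : Function.Injective x) (hy : Function.Injective y)
    {u v : QuadLattice x y} (h : u < v) :
    ∃ e ∈ u.carrier, e ∉ v.carrier ∧
      quadHull x y (insert e v.carrier) ⊆ insert e v.carrier := by
  have hne : (u.carrier \ v.carrier).Nonempty := Set.nonempty_of_ssubset (lt_iff.1 h)
  -- A smallest hull adds only `e`: the hull of any other added point lies inside it, hence equals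
  -- it, against anti-exchange.
  obtain ⟨e, ⟨heu, hev⟩, hmin⟩ := Set.exists_min_image (u.carrier \ v.carrier)
    (fun e => (quadHull x y (insert e v.carrier)).ncard) (Set.toFinite _) hne
  refine ⟨e, heu, hev, fun f hf => ?_⟩
  by_contra hcon
  rw [Set.mem_insert_iff, not_or] at hcon
  have hfu : f ∈ u.carrier := by
    refine u.hull_subset (quadHull_mono x y ?_ hf)
    exact Set.insert_subset heu h.le
  have hsub : quadHull x y (insert f v.carrier) ⊆ quadHull x y (insert e v.carrier) := by
    refine (quadHull_mono x y (Set.insert_subset hf ?_)).trans (quadHull_quadHull x y _)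
    exact (Set.subset_insert _ _).trans (subset_quadHull x y _)
  have heq := Set.eq_of_subset_of_ncard_le hsub (hmin f ⟨hfu, hcon.2⟩) (Set.toFinite _)
  refine anti_exchange hx hy hcon.2 hcon.1 hf ?_
  rw [heq]
  exact subset_quadHull x y _ (Set.mem_insert _ _)

theorem covBy_iff [Finite E] (hx : Function.Injective x) (hy : Function.Injective y)
    {u v : QuadLattice x y} : u ⋖ v ↔ ∃ e ∉ v.carrier, u.carrier = insert e v.carrier := by
  constructor
  · intro h
    obtain ⟨e, heu, hev, hcl⟩ := exists_insert hx hy h.lt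
    refine ⟨e, hev, ?_⟩
    let w : QuadLattice x y := ⟨insert e v.carrier, hcl⟩
    have huw : u ≤ w := Set.insert_subset heu h.le
    have hwv : w < v := lt_iff.2 (Set.ssubset_insert hev)
    rcases huw.eq_or_lt with h' | h'
    · exact congrArg carrier h'
    · exact absurd hwv (h.2 h')
  · rintro ⟨e, hev, he⟩
    refine ⟨lt_iff.2 (he ▸ Set.ssubset_insert hev), fun w huw hwv => ?_⟩
    have h1 := lt_iff.1 huw
    have h2 := lt_iff.1 hwv
    rw [he] at h1
    obtain ⟨f, hfw, hfv⟩ := Set.exists_of_ssubset h2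
    have hfe : f = e := (h1.subset hfw).resolve_right hfv
    exact h1.2 (Set.insert_subset (hfe ▸ hfw) h2.subset)

/-! ### Congruences of quadrant lattices -/

/-- The points `e` for which the congruence collapses the prime interval
`[quad x y e, openQuad x y e]`. -/
def labels (θ : LatticeCon (QuadLattice x y)) : Set E :=
  {e | θ.r (quad x y e) (openQuad x y e)}

/-- Joining with `quad x y e` sends `u` to `quad x y e` and `v` above `openQuad x y e`, so the prime
interval at `e` collapses too. -/
theorem mem_labels_of_rel (hx : Function.Injective x) (hy : Function.Injective y)
    {θ : LatticeCon (QuadLattice x y)} {u v : QuadLattice x y} (h : θ.r u v) {e : E}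
    (heu : e ∈ u.carrier) (hev : e ∉ v.carrier) : e ∈ labels θ := by
  have h1 : θ.r (quad x y e) (v ⊔ quad x y e) := by
    have := θ.sup h (θ.iseqv.refl (quad x y e))
    rwa [sup_eq_right.2 (le_quad_iff.2 heu)] at this
  have h2 : openQuad x y e ≤ v ⊔ quad x y e := by
    rintro f ⟨hf, hf'⟩
    exact mem_openQuad_of_mem_quad hx hy hf' fun h => hev (h ▸ hf)
  have h3 := θ.sup h1 (θ.iseqv.refl (openQuad x y e))
  rw [sup_eq_right.2 (quad_le_openQuad e), sup_eq_left.2 h2] at h3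
  exact θ.iseqv.trans h1 (θ.iseqv.symm h3)

/-- Points are inserted into `v` one at a time; each such step is the meet of `v` with the collapsed
pair `quad x y e`, `openQuad x y e`. -/
theorem rel_of_le_of_diff_subset [Finite E] (hx : Function.Injective x)
    (hy : Function.Injective y) (θ : LatticeCon (QuadLattice x y)) (u : QuadLattice x y) (n : ℕ) :
    ∀ v : QuadLattice x y, u ≤ v → u.carrier \ v.carrier ⊆ labels θ →
      (u.carrier \ v.carrier).ncard = n → θ.r u v := by
  induction n with
  | zero =>
    intro v huv _ hn
    have h : u.carrier \ v.carrier = ∅ := (Set.ncard_eq_zero (Set.toFinite _)).1 hn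
    have : u = v := le_antisymm huv (Set.sdiff_eq_empty.1 h)
    exact this ▸ θ.iseqv.refl u
  | succ n ih =>
    intro v huv hsub hn
    have hlt : u < v := by
      refine huv.lt_of_ne fun h => ?_
      subst h
      simp at hn
    obtain ⟨e, heu, hev, hcl⟩ := exists_insert hx hy hlt
    let w : QuadLattice x y := ⟨insert e v.carrier, hcl⟩
    have huw : u ≤ w := Set.insert_subset heu huv
    have hdiff : u.carrier \ w.carrier = (u.carrier \ v.carrier) \ {e} := by
      rw [Set.sdiff_sdiff, Set.union_singleton]
    have h1 : θ.r u w := by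
      refine ih w huw ?_ ?_
      · rw [hdiff]
        exact Set.sdiff_subset.trans hsub
      · rw [hdiff, Set.ncard_sdiff_singleton_of_mem (Set.mem_sdiff_of_mem heu hev), hn]
        rfl
    have h2 : v ⊓ quad x y e = w := by
      refine le_antisymm ?_ (le_inf (Set.subset_insert _ _) (le_quad_iff.2 (Set.mem_insert _ _)))
      exact Set.insert_subset (le_quad_iff.1 inf_le_right)
        (inf_le_left : v ⊓ quad x y e ≤ v)
    have h3 : v ⊓ openQuad x y e = v := by
      refine inf_eq_left.2 fun f hf => ?_
      have hfw : f ∈ w.carrier :=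
        mem_of_le (Set.mem_insert e v.carrier) hf.1.le hf.2.le
      refine hfw.resolve_left fun h => ?_
      exact lt_irrefl _ (h ▸ hf.1)
    have h4 := θ.inf (θ.iseqv.refl v) (hsub ⟨heu, hev⟩)
    rw [h2, h3] at h4
    exact θ.iseqv.trans h1 h4

theorem rel_iff [Finite E] (hx : Function.Injective x) (hy : Function.Injective y)
    (θ : LatticeCon (QuadLattice x y)) (u v : QuadLattice x y) :
    θ.r u v ↔ ∀ e ∉ labels θ, e ∈ u.carrier ↔ e ∈ v.carrier := by
  constructor
  · intro h e he
    by_contra hcon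
    by_cases heu : e ∈ u.carrier
    · exact he (mem_labels_of_rel hx hy h heu (by tauto))
    · exact he (mem_labels_of_rel hx hy (θ.iseqv.symm h) (e := e) (by tauto) heu)
  · intro h
    have h1 : θ.r u (u ⊔ v) := by
      refine rel_of_le_of_diff_subset hx hy θ u _ _ le_sup_left ?_ rfl
      rintro e ⟨he, he'⟩
      by_contra hcon
      exact he' ⟨he, (h e hcon).1 he⟩
    have h2 : θ.r v (u ⊔ v) := by
      refine rel_of_le_of_diff_subset hx hy θ v _ _ le_sup_right ?_ rfl
      rintro e ⟨he, he'⟩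
      by_contra hcon
      exact he' ⟨(h e hcon).2 he, he⟩
    exact θ.iseqv.trans h1 (θ.iseqv.symm h2)

end QuadLattice

/-- Among the points to the upper left of `t`, `e` is the one nearest to `t` in the first
coordinate, and there is a point to the lower right of `t`. -/
def LeftPred (x y : E → ℕ) (e t : E) : Prop :=
  x e < x t ∧ y t < y e ∧ (∀ h, x e < x h → x h < x t → y h < y t) ∧ ∃ s, x t < x s ∧ y s < y t

/-- The relation that generates the order of the join-irreducible congruences of a quadrant
lattice: a congruence that collapses `e` collapses `t`. -/
def QuadPred (x y : E → ℕ) (e t : E) : Prop := LeftPred x y e t ∨ LeftPred y x e t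

theorem exists_leftPred [Finite E] {x y : E → ℕ} (hy : Function.Injective y) {t p s : E}
    (hp : x p < x t ∧ y t < y p) (hs : x t < x s ∧ y s < y t) :
    ∃ e, LeftPred x y e t ∧ x p ≤ x e := by
  obtain ⟨e, ⟨he1, he2⟩, hmax⟩ := Set.exists_max_image {e | x e < x t ∧ y t < y e} x
    (Set.toFinite _) ⟨p, hp⟩
  refine ⟨e, ⟨he1, he2, fun h hh hh' => ?_, s, hs⟩, hmax p hp⟩
  by_contra! hcon
  rcases hcon.eq_or_lt with heq | hlt
  · rw [hy heq] at hh'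
    exact lt_irrefl _ hh'
  · have := hmax h ⟨hh', hlt⟩
    omega

/-- The sets that are closed under a relation, ordered by inclusion. -/
abbrev ClosedSets (R : E → E → Prop) : Type _ := {T : Set E // ∀ e t, R e t → e ∈ T → t ∈ T}

instance (R : E → E → Prop) : DistribLattice (ClosedSets R) :=
  Subtype.distribLattice (P := fun T : Set E => ∀ e t, R e t → e ∈ T → t ∈ T)
    (fun _ _ hS hT e t h he => he.imp (hS e t h) (hT e t h))
    (fun _ _ hS hT e t h he => ⟨hS e t h he.1, hT e t h he.2⟩)

/-! ### Label sets of congruences are the closed sets -/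

namespace QuadLattice

variable {x y : E → ℕ}

/-- If no such `s` exists, `f` is in neither `u` nor `w`, and it is bounded on the left by a point
of `u` and below by a point of `w`. These lie to its upper left and lower right, so `f` has a left
predecessor `e`. It is outside `T` since `f` is, lies in the same hull, and is further left: induct.
-/
theorem exists_le_of_mem_quadHull [Finite E] (hx : Function.Injective x)
    (hy : Function.Injective y) {T : Set E} (hT : ∀ e t, LeftPred x y e t → e ∈ T → t ∈ T)
    {u v w : Set E} (hu : quadHull x y u ⊆ u) (huv : ∀ e ∉ T, e ∈ u → e ∈ v) (n : ℕ) :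
    ∀ f ∉ T, x f = n → f ∈ quadHull x y (u ∪ w) → ∃ s ∈ v ∪ w, x s ≤ x f := by
  induction n using Nat.strong_induction_on with
  | _ n ih =>
    intro f hfT hfn hf
    by_contra! hcon
    obtain ⟨⟨s, hs, hs'⟩, ⟨t, ht, ht'⟩⟩ := hf
    have hfu : f ∉ u := fun h => (hcon f (Or.inl (huv f hfT h))).false
    have hfw : f ∉ w := fun h => (hcon f (Or.inr h)).false
    have hsu : s ∈ u := hs.resolve_right fun h => (hcon s (Or.inr h)).not_ge hs'
    have htw : t ∈ w := ht.resolve_left fun h => hfu (hu ⟨⟨s, hsu, hs'⟩, ⟨t, h, ht'⟩⟩)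
    have hsf : x s < x f := hs'.lt_of_ne fun h => hfu (hx h ▸ hsu)
    have hfs : y f < y s := by
      by_contra! h
      exact hfu (hu ⟨⟨s, hsu, hs'⟩, ⟨s, hsu, h⟩⟩)
    have htf : y t < y f := ht'.lt_of_ne fun h => hfw (hy h ▸ htw)
    obtain ⟨e, he, hse⟩ := exists_leftPred hy ⟨hsf, hfs⟩ ⟨hcon t (Or.inr htw), htf⟩
    obtain ⟨r, hr, hr'⟩ := ih (x e) (hfn ▸ he.1) e (fun h => hfT (hT e f he h)) rfl
      ⟨⟨s, hs, hse⟩, ⟨t, ht, ht'.trans he.2.1.le⟩⟩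
    have h1 := hcon r hr
    have h2 := he.1
    omega

theorem mem_quadHull_union [Finite E] (hx : Function.Injective x)
    (hy : Function.Injective y) {T : Set E} (hT : ∀ e t, QuadPred x y e t → e ∈ T → t ∈ T)
    {u v w : Set E} (hu : quadHull x y u ⊆ u) (huv : ∀ e ∉ T, e ∈ u → e ∈ v) {f : E} (hf : f ∉ T)
    (h : f ∈ quadHull x y (u ∪ w)) : f ∈ quadHull x y (v ∪ w) := by
  refine ⟨exists_le_of_mem_quadHull hx hy (fun e t h => hT e t (Or.inl h)) hu huv _ f hf rfl h,
    exists_le_of_mem_quadHull hy hx (fun e t h => hT e t (Or.inr h)) ?_ huv _ f hf rfl ?_⟩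
  · rwa [quadHull_swap]
  · rwa [quadHull_swap]

/-- The congruence that identifies quadrants differing only by points of a closed set. -/
def conOfClosed [Finite E] (hx : Function.Injective x) (hy : Function.Injective y)
    (T : ClosedSets (QuadPred x y)) : LatticeCon (QuadLattice x y) where
  r u v := ∀ e ∉ T.1, e ∈ u.carrier ↔ e ∈ v.carrier
  iseqv :=
    { refl := fun _ _ _ => Iff.rfl
      symm := fun h e he => (h e he).symm
      trans := fun h h' e he => (h e he).trans (h' e he) }
  sup h h' e he := and_congr (h e he) (h' e he)
  inf := by
    intro u v w z h h' e he
    rw [carrier_inf, carrier_inf]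
    constructor
    · intro hmem
      -- The two arguments of the meet are replaced one at a time.
      have h1 := mem_quadHull_union hx hy T.2 u.hull_subset (fun e he => (h e he).1) he hmem
      rw [Set.union_comm] at h1 ⊢
      exact mem_quadHull_union hx hy T.2 w.hull_subset (fun e he => (h' e he).1) he h1
    · intro hmem
      have h1 := mem_quadHull_union hx hy T.2 v.hull_subset (fun e he => (h e he).2) he hmem
      rw [Set.union_comm] at h1 ⊢
      exact mem_quadHull_union hx hy T.2 z.hull_subset (fun e he => (h' e he).2) he h1

/-- Meet the collapsed pair at `e` with the half-plane strictly right of `t`. The hull with `quad x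
y e` contains `t`, bounded by `e` on the left and by `s` below; the hull with `openQuad x y e` does
not, since by nearness of `e` no point strictly above and right of `e` reaches as far left as `t`.
-/
theorem mem_labels_of_leftPred (hx : Function.Injective x) (hy : Function.Injective y)
    {θ : LatticeCon (QuadLattice x y)} {e t : E} (h : LeftPred x y e t) (he : e ∈ labels θ) :
    t ∈ labels θ := by
  obtain ⟨h1, h2, h3, s, hs1, hs2⟩ := h
  let w : QuadLattice x y := ⟨{f | x t < x f}, fun f hf => by
    obtain ⟨⟨r, hr, hr'⟩, -⟩ := hf
    exact lt_of_lt_of_le hr hr'⟩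
  refine mem_labels_of_rel hx hy (θ.inf he (θ.iseqv.refl w)) (e := t)
    ⟨⟨e, Or.inl ⟨le_rfl, le_rfl⟩, h1.le⟩, ⟨s, Or.inr hs1, hs2.le⟩⟩ ?_
  rintro ⟨⟨r, hr, hr'⟩, -⟩
  rcases hr with hr | hr
  · rcases hr'.eq_or_lt with heq | hlt
    · have := hr.2
      rw [hx heq] at this
      omega
    · have := h3 r hr.1 hlt
      have := hr.2
      omega
  · exact hr'.not_gt hr

theorem mem_labels_of_leftPred_swap (hx : Function.Injective x) (hy : Function.Injective y)
    {θ : LatticeCon (QuadLattice x y)} {e t : E} (h : LeftPred y x e t) (he : e ∈ labels θ) :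
    t ∈ labels θ := by
  obtain ⟨h1, h2, h3, s, hs1, hs2⟩ := h
  let w : QuadLattice x y := ⟨{f | y t < y f}, fun f hf => by
    obtain ⟨-, ⟨r, hr, hr'⟩⟩ := hf
    exact lt_of_lt_of_le hr hr'⟩
  refine mem_labels_of_rel hx hy (θ.inf he (θ.iseqv.refl w)) (e := t)
    ⟨⟨s, Or.inr hs1, hs2.le⟩, ⟨e, Or.inl ⟨le_rfl, le_rfl⟩, h1.le⟩⟩ ?_
  rintro ⟨-, ⟨r, hr, hr'⟩⟩
  rcases hr with hr | hr
  · rcases hr'.eq_or_lt with heq | hlt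
    · have := hr.1
      rw [hy heq] at this
      omega
    · have := h3 r hr.2 hlt
      have := hr.1
      omega
  · exact hr'.not_gt hr

theorem labels_conOfClosed [Finite E] (hx : Function.Injective x) (hy : Function.Injective y)
    (T : ClosedSets (QuadPred x y)) : labels (conOfClosed hx hy T) = T.1 := by
  ext e
  constructor
  · intro h
    by_contra he
    exact lt_irrefl _ ((h e he).1 ⟨le_rfl, le_rfl⟩).1
  · intro he f hf
    exact ⟨fun h => mem_openQuad_of_mem_quad hx hy h fun h' => hf (h' ▸ he),
      fun h => quad_le_openQuad e h⟩

/-- The congruence lattice of a quadrant lattice. -/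
def conOrderIso [Finite E] (hx : Function.Injective x) (hy : Function.Injective y) :
    LatticeCon (QuadLattice x y) ≃o ClosedSets (QuadPred x y) where
  toFun θ := ⟨labels θ, fun _ _ h => h.elim (mem_labels_of_leftPred hx hy)
    (mem_labels_of_leftPred_swap hx hy)⟩
  invFun := conOfClosed hx hy
  left_inv θ := LatticeCon.toSetoid_inj <| Setoid.ext fun u v => by
    change (∀ e ∉ labels θ, e ∈ u.carrier ↔ e ∈ v.carrier) ↔ θ.r u v
    rw [rel_iff hx hy]
  right_inv T := Subtype.ext (labels_conOfClosed hx hy T)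
  map_rel_iff' {θ θ'} := by
    constructor
    · intro h u v huv
      exact (rel_iff hx hy θ' u v).2 fun e he => (rel_iff hx hy θ u v).1 huv e fun h' => he (h h')
    · exact fun h e he => h he

end QuadLattice

end Quadrants

namespace QuadLattice

variable {E : Type*} {x y : E → ℕ}

/-! ### Quadrant lattices are slim and semimodular -/

theorem isUpperModularLattice [Finite E] (hx : Function.Injective x)
    (hy : Function.Injective y) : IsUpperModularLattice (QuadLattice x y) where
  covBy_sup_of_inf_covBy {a b} h := by
    obtain ⟨e, hea, he⟩ := (covBy_iff hx hy).1 h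
    have hb : b.carrier ⊆ insert e a.carrier := he ▸ (inf_le_right : a ⊓ b ≤ b)
    have heb : e ∈ b.carrier := by
      by_contra hcon
      have hba : b.carrier ⊆ a.carrier := fun f hf => (hb hf).resolve_left fun h => hcon (h ▸ hf)
      exact h.lt.ne (inf_eq_left.2 hba)
    refine (covBy_iff hx hy).2 ⟨e, fun h => hea h.1, ?_⟩
    refine Set.Subset.antisymm (fun f hf => ?_) (Set.insert_subset heb Set.inter_subset_right)
    exact (hb hf).imp id fun h => ⟨h, hf⟩

theorem upper_total (z : E → ℕ) {S T : Set E} (hS : ∀ e f, z e ≤ z f → e ∈ S → f ∈ S)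
    (hT : ∀ e f, z e ≤ z f → e ∈ T → f ∈ T) : S ⊆ T ∨ T ⊆ S := by
  by_contra! h
  obtain ⟨⟨e, he, he'⟩, ⟨f, hf, hf'⟩⟩ := And.imp Set.not_subset.1 Set.not_subset.1 h
  rcases le_total (z e) (z f) with h | h
  · exact hf' (hS e f h he)
  · exact he' (hT f e h hf)

/-- Every quadrant is the intersection, that is the join, of a right and an upper half-plane.
Half-planes of one kind form a chain, whence slimness. -/
theorem upper_or_upper_of_supIrred {u : QuadLattice x y} (hu : SupIrred u) :
    (∀ e f, x e ≤ x f → e ∈ u.carrier → f ∈ u.carrier) ∨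
      ∀ e f, y e ≤ y f → e ∈ u.carrier → f ∈ u.carrier := by
  let v : QuadLattice x y := ⟨{e | ∃ s ∈ u.carrier, x s ≤ x e}, by
    rintro e ⟨⟨s, ⟨s', hs', h⟩, hs⟩, -⟩
    exact ⟨s', hs', h.trans hs⟩⟩
  let w : QuadLattice x y := ⟨{e | ∃ s ∈ u.carrier, y s ≤ y e}, by
    rintro e ⟨-, ⟨s, ⟨s', hs', h⟩, hs⟩⟩
    exact ⟨s', hs', h.trans hs⟩⟩
  have h : v ⊔ w = u := by
    refine QuadLattice.ext (Set.Subset.antisymm u.hull_subset ?_)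
    exact subset_quadHull x y u.carrier
  rcases hu.2 h with h | h
  · refine Or.inl fun e f hef he => ?_
    rw [← h]
    exact ⟨e, he, hef⟩
  · refine Or.inr fun e f hef he => ?_
    rw [← h]
    exact ⟨e, he, hef⟩

theorem isSlimSemimodularLattice [Finite E] (hx : Function.Injective x)
    (hy : Function.Injective y) : IsSlimSemimodularLattice (QuadLattice x y) where
  finite := inferInstance
  nonempty := ⟨⟨∅, fun _ h => by obtain ⟨⟨_, h, _⟩, _⟩ := h; exact h⟩⟩
  semimodular := isUpperModularLattice hx hy
  jir_eq_union := by
    refine ⟨{u | SupIrred u ∧ ∀ e f, x e ≤ x f → e ∈ u.carrier → f ∈ u.carrier},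
      {u | SupIrred u ∧ ∀ e f, y e ≤ y f → e ∈ u.carrier → f ∈ u.carrier}, ?_, ?_, ?_⟩
    · exact fun u hu v hv _ => (upper_total x hu.2 hv.2).symm
    · exact fun u hu v hv _ => (upper_total y hu.2 hv.2).symm
    · ext u
      refine ⟨fun h => (upper_or_upper_of_supIrred h).imp (And.intro h) (And.intro h), ?_⟩
      exact fun h => h.elim And.left And.left

end QuadLattice

/-! ### Slim semimodular lattices are quadrant lattices -/

section Coordinatization

variable {L : Type*} [Lattice L]

theorem exists_supIrred_le_not_le [Finite L] {a b : L} (h : ¬ a ≤ b) :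
    ∃ j, SupIrred j ∧ j ≤ a ∧ ¬ j ≤ b := by
  have : Nonempty L := ⟨a⟩
  let := Fintype.ofFinite L
  let : OrderBot L := (Fintype.toBoundedOrder L).toOrderBot
  obtain ⟨s, hs, hs'⟩ := exists_supIrred_decomposition a
  by_contra! hcon
  refine h (hs ▸ Finset.sup_le fun j hj => hcon j (hs' hj) ?_)
  exact hs ▸ Finset.le_sup (f := id) hj

theorem exists_infIrred_le_not_le [Finite L] {a b : L} (h : ¬ a ≤ b) :
    ∃ m, InfIrred m ∧ b ≤ m ∧ ¬ a ≤ m := by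
  obtain ⟨m, hm, h1, h2⟩ := exists_supIrred_le_not_le (L := Lᵒᵈ) (a := OrderDual.toDual b)
    (b := OrderDual.toDual a) h
  exact ⟨OrderDual.ofDual m, infIrred_ofDual.2 hm, h1, h2⟩

theorem CovBy.inf_eq_of_ne {z p q : L} (hp : z ⋖ p) (hq : z ⋖ q) (h : p ≠ q) : p ⊓ q = z := by
  by_contra hcon
  have hlt : z < p ⊓ q := (le_inf hp.le hq.le).lt_of_ne (Ne.symm hcon)
  have h1 : p ⊓ q = p := (inf_le_left.eq_or_lt).resolve_right (hp.2 hlt)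
  have h2 : p ⊓ q = q := (inf_le_right.eq_or_lt).resolve_right (hq.2 hlt)
  exact h (h1.symm.trans h2)

/-- In a slim lattice an element has at most two upper covers. -/
theorem IsSlimLattice.eq_of_covBy (hL : IsSlimLattice L) {z p q r : L} (hp : z ⋖ p) (hq : z ⋖ q)
    (hr : z ⋖ r) (hpq : p ≠ q) (hpr : p ≠ r) : q = r := by
  by_contra hqr
  have := hL.finite
  obtain ⟨C, C', hC, hC', hJ⟩ := hL.jir_eq_union
  obtain ⟨i, hi, hip, hiz⟩ := exists_supIrred_le_not_le hp.lt.not_ge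
  obtain ⟨j, hj, hjq, hjz⟩ := exists_supIrred_le_not_le hq.lt.not_ge
  obtain ⟨k, hk, hkr, hkz⟩ := exists_supIrred_le_not_le hr.lt.not_ge
  -- Distinct covers of `z` meet in `z`, so `i`, `j`, `k` are pairwise incomparable, too many for
  -- two chains.
  have key : ∀ {a b c d : L}, z ⋖ a → z ⋖ b → a ≠ b → c ≤ a → d ≤ b → ¬ c ≤ z → ¬ d ≤ z →
      ∀ S : Set L, IsChain (· ≤ ·) S → c ∈ S → d ∈ S → False := by
    intro a b c d ha hb hab hca hdb hcz hdz S hS hc hd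
    rcases hS.total hc hd with h | h
    · exact hcz ((le_inf hca (h.trans hdb)).trans_eq (ha.inf_eq_of_ne hb hab))
    · exact hdz ((le_inf (h.trans hca) hdb).trans_eq (ha.inf_eq_of_ne hb hab))
  have hi' : i ∈ C ∪ C' := hJ ▸ hi
  have hj' : j ∈ C ∪ C' := hJ ▸ hj
  have hk' : k ∈ C ∪ C' := hJ ▸ hk
  have kij := key hp hq hpq hip hjq hiz hjz
  have kik := key hp hr hpr hip hkr hiz hkz
  have kjk := key hq hr hqr hjq hkr hjz hkz
  rcases hi' with hi | hi <;> rcases hj' with hj | hj <;> rcases hk' with hk | hk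
  · exact kij C hC hi hj
  · exact kij C hC hi hj
  · exact kik C hC hi hk
  · exact kjk C' hC' hj hk
  · exact kjk C hC hj hk
  · exact kik C' hC' hi hk
  · exact kij C' hC' hi hj
  · exact kij C' hC' hi hj

/-- The number of elements of the maximal chain `s` that lie below `m`. -/
noncomputable def flagHeight (s : Flag L) (m : L) : ℕ := {c | c ∈ s ∧ c ≤ m}.ncard

/-- The elements of a chain below a given element form an initial segment, so comparing sizes is
comparing sets. -/
theorem flagHeight_le_iff [Finite L] (s : Flag L) {m n : L} :
    flagHeight s m ≤ flagHeight s n ↔ ∀ c ∈ s, c ≤ m → c ≤ n := by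
  constructor
  · intro h c hc hcm
    by_contra hcn
    refine h.not_gt (Set.ncard_lt_ncard ?_ (Set.toFinite _))
    rw [Set.ssubset_iff_of_subset]
    · exact ⟨c, ⟨hc, hcm⟩, fun h => hcn h.2⟩
    · rintro d ⟨hd, hdn⟩
      refine ⟨hd, ?_⟩
      rcases s.le_or_le hd hc with h' | h'
      · exact h'.trans hcm
      · exact absurd (h'.trans hdn) hcn
  · intro h
    exact Set.ncard_le_ncard (fun c hc => ⟨hc.1, h c hc.1 hc.2⟩) (Set.toFinite _)

theorem exists_mem_flag_not_le [Finite L] (s : Flag L) {m : L} (hm : ¬ IsMax m) :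
    ∃ c ∈ s, ¬ c ≤ m := by
  have : Nonempty L := ⟨m⟩
  let := Fintype.ofFinite L
  let : BoundedOrder L := Fintype.toBoundedOrder L
  refine ⟨⊤, s.top_mem, fun h => hm ?_⟩
  rw [top_le_iff.1 h]
  exact isMax_top

theorem exists_flag_covBy [Finite L] (s : Flag L) {m : L} (hm : ¬ IsMax m) :
    ∃ c ∈ s, ∃ d ∈ s, c ⋖ d ∧ c ≤ m ∧ ¬ d ≤ m := by
  have : Nonempty L := ⟨m⟩
  let := Fintype.ofFinite L
  let : BoundedOrder L := Fintype.toBoundedOrder L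
  obtain ⟨d, ⟨hd, hdm⟩, hdmin⟩ := Set.Finite.exists_minimal (s := {c | c ∈ s ∧ ¬ c ≤ m})
    (Set.toFinite _) (exists_mem_flag_not_le s hm)
  obtain ⟨c, ⟨hc, hcm⟩, hcmax⟩ := Set.Finite.exists_maximal (s := {c | c ∈ s ∧ c ≤ m})
    (Set.toFinite _) ⟨⊥, s.bot_mem, bot_le⟩
  have hcd : c < d := by
    rcases s.le_or_le hc hd with h | h
    · exact h.lt_of_ne fun h' => hdm (h' ▸ hcm)
    · exact absurd (h.trans hcm) hdm
  refine ⟨c, hc, d, hd, ⟨hcd, fun z hcz hzd => ?_⟩, hcm, hdm⟩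
  -- An element strictly between `c` and `d` is comparable with the whole flag, hence belongs to it.
  have hz : z ∈ s := by
    have hins : IsChain (· ≤ ·) (insert z (s : Set L)) := by
      refine s.chain_le.insert fun b hb _ => ?_
      by_cases hbm : b ≤ m
      · right
        rcases s.le_or_le hb hc with h | h
        · exact h.trans hcz.le
        · exact (hcmax ⟨hb, hbm⟩ h).trans hcz.le
      · left
        rcases s.le_or_le hb hd with h | h
        · exact hzd.le.trans (hdmin ⟨hb, hbm⟩ h)
        · exact hzd.le.trans h
    have := s.max_chain' hins (Set.subset_insert _ _)
    change z ∈ (s : Set L)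
    have h2 : (s : Set L) = insert z (s : Set L) := this
    rw [h2]
    exact Set.mem_insert _ _
  by_cases hzm : z ≤ m
  · exact (hcmax ⟨hz, hzm⟩ hcz.le).not_gt hcz
  · exact (hdmin ⟨hz, hzm⟩ hzd.le).not_gt hzd

/-- Equal heights mean that `m` and `n` split the flag at the same `c ⋖ d`. By semimodularity `z ⋖ d
⊔ z` whenever `z` is above `c` but not above `d`. If `m < n`, then `(d ⊔ m) ⊓ n = m` contradicts
meet-irreducibility; if `m` and `n` are incomparable, `m ⊓ n` has three covers: one below `m`, one
below `n`, and `d ⊔ m ⊓ n`. -/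
theorem IsSlimSemimodularLattice.flagHeight_injective (hL : IsSlimSemimodularLattice L) (s : Flag L) :
    Function.Injective fun m : {m : L // InfIrred m} => flagHeight s m.1 := by
  have := hL.finite
  have := hL.semimodular
  rintro ⟨m, hm⟩ ⟨n, hn⟩ hmn
  change flagHeight s m = flagHeight s n at hmn
  obtain ⟨c, hc, d, hd, hcd, hcm, hdm⟩ := exists_flag_covBy s hm.1
  have hcn : c ≤ n := (flagHeight_le_iff s).1 hmn.le c hc hcm
  have hdn : ¬ d ≤ n := fun h => hdm ((flagHeight_le_iff s).1 hmn.ge d hd h)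
  have hcov : ∀ z, c ≤ z → ¬ d ≤ z → z ⋖ d ⊔ z := by
    intro z hcz hdz
    refine IsUpperModularLattice.covBy_sup_of_inf_covBy ?_
    have hlt : d ⊓ z < d := inf_le_left.lt_of_ne fun h => hdz (inf_eq_left.1 h)
    have : d ⊓ z = c := ((le_inf hcd.le hcz).eq_or_lt.resolve_right fun h => hcd.2 h hlt).symm
    rwa [this]
  have aux : ∀ {m n : L}, InfIrred m → c ≤ m → ¬ d ≤ m → ¬ d ≤ n → m ≤ n → m = n := by
    intro m n hm hcm hdm hdn hmn
    have h1 := hcov m hcm hdm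
    have h2 : (d ⊔ m) ⊓ n = m := by
      refine ((le_inf h1.le hmn).eq_or_lt.resolve_right fun h => h1.2 h ?_).symm
      exact inf_le_left.lt_of_ne fun h' => hdn (le_sup_left.trans (inf_eq_left.1 h'))
    rcases hm.2 h2 with h3 | h3
    · exact absurd (le_sup_left.trans_eq h3) hdm
    · exact h3.symm
  refine Subtype.ext ?_
  change m = n
  by_cases h1 : m ≤ n
  · exact aux hm hcm hdm hdn h1
  by_cases h2 : n ≤ m
  · exact (aux hn hcn hdn hdm h2).symm
  exfalso
  have hz1 : m ⊓ n < m := inf_le_left.lt_of_ne fun h => h1 (inf_eq_left.1 h)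
  have hz2 : m ⊓ n < n := inf_le_right.lt_of_ne fun h => h2 (inf_eq_right.1 h)
  obtain ⟨p, hp, hpm⟩ := exists_covBy_le_of_lt hz1
  obtain ⟨q, hq, hqn⟩ := exists_covBy_le_of_lt hz2
  have hr := hcov (m ⊓ n) (le_inf hcm hcn) fun h => hdm (h.trans inf_le_left)
  have hpq : p ≠ q := fun h => hp.lt.not_ge (le_inf hpm (h ▸ hqn))
  have hpr : p ≠ d ⊔ m ⊓ n := fun h => hdm (le_sup_left.trans (h ▸ hpm))
  have hqr : q ≠ d ⊔ m ⊓ n := fun h => hdn (le_sup_left.trans (h ▸ hqn))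
  exact hqr (hL.toIsSlimLattice.eq_of_covBy hp hq hr hpq hpr)

/-- Were all heights in `K` larger, the least flag element not below `m` would lie below every
member of `K`, hence below `m`. -/
theorem le_of_flagHeight_le [Finite L] {s : Flag L} {K : Set L} {m : L} (hm : ¬ IsMax m)
    (h : ∀ c ∈ s, (∀ k ∈ K, c ≤ k) → c ≤ m) : ∃ k ∈ K, flagHeight s k ≤ flagHeight s m := by
  by_contra! hcon
  obtain ⟨c, ⟨hc, hcm⟩, hcmin⟩ := Set.Finite.exists_minimal (s := {c | c ∈ s ∧ ¬ c ≤ m})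
    (Set.toFinite _) (exists_mem_flag_not_le s hm)
  refine hcm (h c hc fun k hk => ?_)
  have h1 := (hcon k hk).not_ge
  rw [flagHeight_le_iff] at h1
  push Not at h1
  obtain ⟨d, hd, hdk, hdm⟩ := h1
  rcases s.le_or_le hc hd with h' | h'
  · exact h'.trans hdk
  · exact (hcmin ⟨hd, hdm⟩ h').trans hdk

theorem IsSlimSemimodularLattice.exists_orderIso {L : Type*} [Lattice L]
    (hL : IsSlimSemimodularLattice L) :
    ∃ x y : {m : L // InfIrred m} → ℕ, Function.Injective x ∧ Function.Injective y ∧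
      Nonempty (L ≃o QuadLattice x y) := by
  have := hL.finite
  have := hL.nonempty
  let := Fintype.ofFinite L
  let : BoundedOrder L := Fintype.toBoundedOrder L
  obtain ⟨C, C', hC, hC', hJ⟩ := hL.jir_eq_union
  obtain ⟨s, hs⟩ := hC.exists_subset_flag
  obtain ⟨t, ht⟩ := hC'.exists_subset_flag
  let x : {m : L // InfIrred m} → ℕ := fun m => flagHeight s m.1
  let y : {m : L // InfIrred m} → ℕ := fun m => flagHeight t m.1
  -- The image is a quadrant because an element is determined by the join-irreducibles below it,
  -- each of which lies on `s` or on `t`.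
  let F : L → QuadLattice x y := fun u => ⟨{m | u ≤ m.1}, by
    rintro m ⟨⟨p, hp, hpm⟩, ⟨q, hq, hqm⟩⟩
    change u ≤ m.1
    by_contra hcon
    obtain ⟨j, hj, hju, hjm⟩ := exists_supIrred_le_not_le hcon
    have hj' : j ∈ C ∪ C' := hJ ▸ hj
    rcases hj' with hj' | hj'
    · exact hjm ((flagHeight_le_iff s).1 hpm j (hs hj') (hju.trans hp))
    · exact hjm ((flagHeight_le_iff t).1 hqm j (ht hj') (hju.trans hq))⟩
  have hF : ∀ u v, F u ≤ F v ↔ u ≤ v := by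
    intro u v
    constructor
    · intro h
      by_contra hcon
      obtain ⟨m, hm, hvm, hum⟩ := exists_infIrred_le_not_le hcon
      exact hum (h (show (⟨m, hm⟩ : {m : L // InfIrred m}) ∈ (F v).carrier from hvm))
    · intro h m hm
      exact h.trans hm
  refine ⟨x, y, hL.flagHeight_injective s, hL.flagHeight_injective t, ⟨?_⟩⟩
  refine RelIso.ofSurjective (OrderEmbedding.ofMapLEIff F hF) fun K => ?_
  classical
  -- The preimage of `K` is the meet of its points; no meet-irreducible outside `K` lies above that
  -- meet.
  let I : Finset L := Finset.univ.filter fun l => ∃ m ∈ K.carrier, m.1 = l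
  have hI : ∀ l : L, l ≤ I.inf id ↔ ∀ m ∈ K.carrier, l ≤ m.1 := by
    intro l
    simp [I, Finset.le_inf_iff]
  refine ⟨I.inf id, QuadLattice.ext (Set.Subset.antisymm ?_ fun m hm => (hI _).1 le_rfl m hm)⟩
  intro m hm
  have hle : I.inf id ≤ m.1 := hm
  have aux : ∀ r : Flag L, ∃ k ∈ K.carrier, flagHeight r k.1 ≤ flagHeight r m.1 := by
    intro r
    obtain ⟨k, ⟨n, hn, rfl⟩, hk'⟩ := le_of_flagHeight_le (s := r) (K := Subtype.val '' K.carrier)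
      m.2.1 fun c _ h => ((hI c).2 fun n hn => h n.1 ⟨n, hn, rfl⟩).trans hle
    exact ⟨n, hn, hk'⟩
  exact K.hull_subset ⟨aux s, aux t⟩

end Coordinatization

/-! ### Rectangular configurations -/

/-- Configurations whose points lie in an ascending upper left chain `A`, an ascending lower right
chain `B` and the lower left box spanned by them. -/
structure IsRectangularConfig {E : Type*} (x y : E → ℕ) (A B : Set E) : Prop where
  nonempty_left : A.Nonempty
  nonempty_right : B.Nonempty
  disjoint : Disjoint A B
  above : ∀ a ∈ A, ∀ e ∉ A, y e < y a
  right : ∀ b ∈ B, ∀ e ∉ B, x e < x b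
  mono_left : ∀ a ∈ A, ∀ a' ∈ A, x a < x a' → y a < y a'
  mono_right : ∀ b ∈ B, ∀ b' ∈ B, y b < y b' → x b < x b'
  exists_left : ∀ e, e ∉ A → e ∉ B → ∃ a ∈ A, x a < x e
  exists_right : ∀ e, e ∉ A → e ∉ B → ∃ b ∈ B, y b < y e

namespace IsRectangularConfig

variable {E : Type*} {x y : E → ℕ} {A B : Set E}

theorem swap (h : IsRectangularConfig x y A B) : IsRectangularConfig y x B A where
  nonempty_left := h.nonempty_right
  nonempty_right := h.nonempty_left
  disjoint := h.disjoint.symm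
  above := h.right
  right := h.above
  mono_left := h.mono_right
  mono_right := h.mono_left
  exists_left e hB hA := h.exists_right e hA hB
  exists_right e hB hA := h.exists_left e hA hB

theorem exists_right_lt (h : IsRectangularConfig x y A B) {e : E} (he : e ∉ B) :
    ∃ b ∈ B, y b < y e := by
  by_cases heA : e ∈ A
  · obtain ⟨b, hb⟩ := h.nonempty_right
    exact ⟨b, hb, h.above e heA b fun hbA => h.disjoint.ne_of_mem hbA hb rfl⟩
  · exact h.exists_right e heA he

theorem exists_right_le (h : IsRectangularConfig x y A B) (e : E) : ∃ b ∈ B, y b ≤ y e := by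
  by_cases he : e ∈ B
  · exact ⟨e, he, le_rfl⟩
  · obtain ⟨b, hb, hbe⟩ := h.exists_right_lt he
    exact ⟨b, hb, hbe.le⟩

/-- `B` ascends, so its lowest point is also its leftmost one. -/
theorem right_eq_quad [Finite E] (h : IsRectangularConfig x y A B) (hy : Function.Injective y) :
    ∃ b ∈ B, B = {f | x b ≤ x f ∧ y b ≤ y f} := by
  obtain ⟨b, hb, hmin⟩ := Set.exists_min_image B y (Set.toFinite _) h.nonempty_right
  refine ⟨b, hb, Set.Subset.antisymm (fun f hf => ⟨?_, hmin f hf⟩) fun f hf => ?_⟩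
  · rcases (hmin f hf).eq_or_lt with heq | hlt
    · rw [hy heq]
    · exact (h.mono_right b hb f hf hlt).le
  · by_contra hfB
    exact (h.right b hb f hfB).not_ge hf.1

theorem right_closed [Finite E] (h : IsRectangularConfig x y A B) (hy : Function.Injective y) :
    quadHull x y B ⊆ B := by
  obtain ⟨b, _, hB⟩ := h.right_eq_quad hy
  rw [hB]
  exact (QuadLattice.quad x y b).hull_subset

/-- The rightmost point outside `B` lies in every quadrant that properly contains `B`. -/
theorem right_inter_irred [Finite E] (h : IsRectangularConfig x y A B) {S T : Set E}
    (hS : quadHull x y S ⊆ S) (hT : quadHull x y T ⊆ T) (hST : S ∩ T = B) : S = B ∨ T = B := by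
  by_contra! hcon
  have hBS : B ⊆ S := hST ▸ Set.inter_subset_left
  have hBT : B ⊆ T := hST ▸ Set.inter_subset_right
  obtain ⟨p, hpS, hpB⟩ := Set.exists_of_ssubset (hBS.ssubset_of_ne hcon.1.symm)
  obtain ⟨q, hqT, hqB⟩ := Set.exists_of_ssubset (hBT.ssubset_of_ne hcon.2.symm)
  obtain ⟨f, hfB, hmax⟩ := Set.exists_max_image Bᶜ x (Set.toFinite _) ⟨p, hpB⟩
  obtain ⟨b, hb, hbf⟩ := h.exists_right_le f
  refine hfB (hST ▸ ⟨hS ⟨⟨p, hpS, hmax p hpB⟩, ⟨b, hBS hb, hbf⟩⟩,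
    hT ⟨⟨q, hqT, hmax q hqB⟩, ⟨b, hBT hb, hbf⟩⟩⟩)

/-- A quadrant at `e` that is also a right half-plane forces `e ∈ B`, as otherwise it would contain
a point of `B` lower than `e`. Then `U` is the intersection of `B` with the upper half-plane at `e`,
and it cannot be that half-plane, which contains points of `A` left of `e`. -/
theorem eq_right_of_irred [Finite E] (h : IsRectangularConfig x y A B)
    (hy : Function.Injective y) {U : Set E}
    (hU : ∀ S T : Set E, quadHull x y S ⊆ S → quadHull x y T ⊆ T → S ∩ T = U → S = U ∨ T = U)
    {e : E} (he : U = {f | x e ≤ x f ∧ y e ≤ y f})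
    (hup : ∀ f g, x f ≤ x g → f ∈ U → g ∈ U) : U = B := by
  have heU : e ∈ U := he ▸ ⟨le_rfl, le_rfl⟩
  have heB : e ∈ B := by
    by_contra heB
    obtain ⟨b, hb, hbe⟩ := h.exists_right_lt heB
    have hbU := hup e b (h.right b hb e heB).le heU
    rw [he] at hbU
    exact hbe.not_ge hbU.2
  have hT : quadHull x y {f | y e ≤ y f} ⊆ {f | y e ≤ y f} := by
    rintro f ⟨-, ⟨s, hs, hs'⟩⟩
    exact le_trans hs hs'
  have hBT : B ∩ {f | y e ≤ y f} = U := by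
    ext f
    rw [he]
    constructor
    · rintro ⟨hfB, hf⟩
      refine ⟨?_, hf⟩
      rcases Nat.eq_or_lt_of_le hf with heq | hlt
      · rw [hy heq]
      · exact (h.mono_right e heB f hfB hlt).le
    · rintro ⟨hf, hf'⟩
      refine ⟨?_, hf'⟩
      by_contra hfB
      exact (h.right e heB f hfB).not_ge hf
  rcases hU B {f | y e ≤ y f} (h.right_closed hy) hT hBT with h1 | h1
  · exact h1.symm
  · obtain ⟨a, ha⟩ := h.nonempty_left
    have haB : a ∉ B := fun h' => h.disjoint.ne_of_mem ha h' rfl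
    have heA : e ∉ A := fun h' => h.disjoint.ne_of_mem h' heB rfl
    have haU : a ∈ U := h1 ▸ (h.above a ha e heA).le
    rw [he] at haU
    exact absurd haU.1 (h.right e heB a haB).not_ge

end IsRectangularConfig

namespace QuadLattice

variable {E : Type*} {x y : E → ℕ}

/-- Phrased with sets of points so that it can be used after exchanging the coordinates, which
changes the type `QuadLattice x y`. -/
theorem supIrred_iff {u : QuadLattice x y} : SupIrred u ↔ u.carrier ≠ Set.univ ∧
    ∀ S T : Set E, quadHull x y S ⊆ S → quadHull x y T ⊆ T → S ∩ T = u.carrier →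
      S = u.carrier ∨ T = u.carrier := by
  constructor
  · rintro ⟨h1, h2⟩
    refine ⟨fun h => h1 fun v _ => le_iff.2 (h ▸ Set.subset_univ _), fun S T hS hT hST => ?_⟩
    have := h2 (b := ⟨S, hS⟩) (c := ⟨T, hT⟩) (QuadLattice.ext hST)
    exact this.imp (congrArg carrier) (congrArg carrier)
  · rintro ⟨h1, h2⟩
    refine ⟨fun h => h1 (Set.univ_subset_iff.1 ?_), fun v w hvw => ?_⟩
    · have hle : (⟨Set.univ, Set.subset_univ _⟩ : QuadLattice x y) ≤ u := Set.subset_univ _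
      exact h hle
    · exact (h2 _ _ v.hull_subset w.hull_subset (congrArg carrier hvw)).imp
        QuadLattice.ext QuadLattice.ext

theorem infIrred_quad (hx : Function.Injective x) (e : E) : InfIrred (quad x y e) := by
  have he : e ∈ (quad x y e).carrier := ⟨le_rfl, le_rfl⟩
  constructor
  · intro h
    have hle : quad x y e ≤ openQuad x y e := quad_le_openQuad e
    exact lt_irrefl _ (h hle he).1
  · intro v w hvw
    have hmem : e ∈ (v ⊓ w).carrier := hvw ▸ he
    obtain ⟨⟨s, hs, hse⟩, -⟩ := hmem
    have hsq : s ∈ (quad x y e).carrier := hvw ▸ subset_quadHull x y _ hs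
    obtain rfl : s = e := hx (le_antisymm hse hsq.1)
    rcases hs with hs | hs
    · exact Or.inl (le_antisymm (le_quad_iff.2 hs) (hvw ▸ inf_le_left))
    · exact Or.inr (le_antisymm (le_quad_iff.2 hs) (hvw ▸ inf_le_right))

/-- A nonempty quadrant is the meet of those generated by its leftmost and its lowest point. -/
theorem exists_eq_quad [Finite E] {u : QuadLattice x y} (hu : InfIrred u) :
    ∃ e, u = quad x y e := by
  have hne : u.carrier.Nonempty := by
    by_contra h
    rw [Set.not_nonempty_iff_eq_empty] at h
    refine hu.1 fun v _ => ?_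
    change u.carrier ⊆ v.carrier
    simp [h]
  obtain ⟨p, hp, hpmin⟩ := Set.exists_min_image u.carrier x (Set.toFinite _) hne
  obtain ⟨q, hq, hqmin⟩ := Set.exists_min_image u.carrier y (Set.toFinite _) hne
  have h : quad x y p ⊓ quad x y q = u := by
    refine le_antisymm (fun f hf => ?_) (le_inf (le_quad_iff.2 hp) (le_quad_iff.2 hq))
    exact ⟨⟨p, Or.inl ⟨le_rfl, le_rfl⟩, hpmin f hf⟩, ⟨q, Or.inr ⟨le_rfl, le_rfl⟩, hqmin f hf⟩⟩
  exact (hu.2 h).elim (fun h => ⟨p, h.symm⟩) fun h => ⟨q, h.symm⟩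

/-- The corners are `A` and `B`: they are disjoint, so their join is the empty quadrant, the top,
and their hull is everything. -/
theorem isSlimRectangularLattice [Finite E] (hx : Function.Injective x)
    (hy : Function.Injective y) {A B : Set E} (h : IsRectangularConfig x y A B) :
    IsSlimRectangularLattice (QuadLattice x y) where
  toIsSlimSemimodularLattice := isSlimSemimodularLattice hx hy
  exists_corners := by
    have hAcl : quadHull x y A ⊆ A := quadHull_swap x y A ▸ h.swap.right_closed hx
    let a : QuadLattice x y := ⟨A, hAcl⟩
    let b : QuadLattice x y := ⟨B, h.right_closed hy⟩
    have hAB : A ∩ B = ∅ := h.disjoint.inter_eq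
    refine ⟨a, b, fun hab => ?_, fun u => ⟨fun hu => ?_, ?_⟩, fun v => ?_, fun v => ?_⟩
    · have : A = B := congrArg carrier hab
      rw [this, Set.inter_self] at hAB
      exact h.nonempty_right.ne_empty hAB
    · obtain ⟨e, he⟩ := exists_eq_quad hu.2
      have he' : u.carrier = {f | x e ≤ x f ∧ y e ≤ y f} := congrArg carrier he
      have hirr := (supIrred_iff.1 hu.1).2
      rcases upper_or_upper_of_supIrred hu.1 with hup | hup
      · exact Or.inr (QuadLattice.ext (h.eq_right_of_irred hy hirr he' hup))
      · refine Or.inl (QuadLattice.ext (h.swap.eq_right_of_irred hx (fun S T hS hT => ?_)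
          (e := e) ?_ hup))
        · rw [quadHull_swap] at hS hT
          exact hirr S T hS hT
        · rw [he']
          ext f
          exact and_comm
    · rintro (rfl | rfl)
      · refine ⟨supIrred_iff.2 ⟨fun huniv => ?_, fun S T hS hT hST => ?_⟩, ?_⟩
        · have : A = Set.univ := huniv
          rw [this, Set.univ_inter] at hAB
          exact h.nonempty_right.ne_empty hAB
        · rw [← quadHull_swap] at hS hT
          exact h.swap.right_inter_irred hS hT hST
        · obtain ⟨e, _, he⟩ := h.swap.right_eq_quad hx
          have : a = quad x y e := QuadLattice.ext <| by
            change A = _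
            rw [he]
            ext f
            exact and_comm
          exact this ▸ infIrred_quad hx e
      · refine ⟨supIrred_iff.2 ⟨fun huniv => ?_, fun S T hS hT hST => ?_⟩, ?_⟩
        · have : B = Set.univ := huniv
          rw [this, Set.inter_univ] at hAB
          exact h.nonempty_left.ne_empty hAB
        · exact h.right_inter_irred hS hT hST
        · obtain ⟨e, _, he⟩ := h.right_eq_quad hy
          have : b = quad x y e := QuadLattice.ext he
          exact this ▸ infIrred_quad hx e
    · intro f _
      obtain ⟨p, hp, hp'⟩ := h.swap.exists_right_le f
      obtain ⟨q, hq, hq'⟩ := h.exists_right_le f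
      exact ⟨⟨p, Or.inl hp, hp'⟩, ⟨q, Or.inr hq, hq'⟩⟩
    · intro f hf
      have : f ∈ A ∩ B := hf
      rw [hAB] at this
      exact this.elim

end QuadLattice

/-! ### Making a configuration rectangular -/

/-- `A` and `B` split the points that have no point to their upper left or no point to their
lower right. -/
structure IsBoundarySplit {E : Type*} (x y : E → ℕ) (A B : Set E) : Prop where
  nonempty_left : A.Nonempty
  nonempty_right : B.Nonempty
  disjoint : Disjoint A B
  left : ∀ a ∈ A, ∀ h, x h < x a → ¬ y a < y h
  right : ∀ b ∈ B, ∀ h, y h < y b → ¬ x b < x h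
  inner_left : ∀ e, e ∉ A → e ∉ B → ∃ h, x h < x e ∧ y e < y h
  inner_right : ∀ e, e ∉ A → e ∉ B → ∃ h, y h < y e ∧ x e < x h

namespace IsBoundarySplit

variable {E : Type*} {x y : E → ℕ} {A B : Set E}

theorem swap (h : IsBoundarySplit x y A B) : IsBoundarySplit y x B A where
  nonempty_left := h.nonempty_right
  nonempty_right := h.nonempty_left
  disjoint := h.disjoint.symm
  left := h.right
  right := h.left
  inner_left e hB hA := h.inner_right e hA hB
  inner_right e hB hA := h.inner_left e hA hB

/-- The highest point to the upper left of `e` has nothing to its own upper left and has `e` to its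
lower right, so it belongs to `A`. -/
theorem exists_left_of_lt [Finite E] (h : IsBoundarySplit x y A B) {e p : E} (hx : x p < x e)
    (hy : y e < y p) : ∃ a ∈ A, x a < x e ∧ y e < y a := by
  obtain ⟨q, ⟨hq1, hq2⟩, hmax⟩ := Set.exists_max_image {q | x q < x e ∧ y e < y q} y
    (Set.toFinite _) ⟨p, hx, hy⟩
  refine ⟨q, ?_, hq1, hq2⟩
  by_contra hqA
  by_cases hqB : q ∈ B
  · exact h.right q hqB e hq2 hq1
  · obtain ⟨r, hr1, hr2⟩ := h.inner_left q hqA hqB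
    exact (hmax r ⟨hr1.trans hq1, hq2.trans hr2⟩).not_gt hr2

end IsBoundarySplit

theorem exists_isBoundarySplit {E : Type*} [Finite E] [Nontrivial E] (x y : E → ℕ) :
    ∃ A B : Set E, IsBoundarySplit x y A B := by
  by_cases hpq : ∃ p q, x p < x q ∧ y q < y p
  · obtain ⟨p, q, hpq1, hpq2⟩ := hpq
    -- Points that qualify for both sides are put into `A`.
    refine ⟨{a | ∀ h, x h < x a → ¬ y a < y h},
      {b | (∀ h, y h < y b → ¬ x b < x h) ∧ ∃ h, x h < x b ∧ y b < y h}, ?_, ?_, ?_, ?_, ?_, ?_, ?_⟩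
    · obtain ⟨a, -, ha⟩ := Set.exists_min_image Set.univ x (Set.toFinite _) ⟨p, trivial⟩
      exact ⟨a, fun h hh => absurd hh (ha h trivial).not_gt⟩
    · obtain ⟨b, ⟨hb1, hb2⟩, hb⟩ := Set.exists_min_image {b | x p < x b ∧ y b < y p} y
        (Set.toFinite _) ⟨q, hpq1, hpq2⟩
      refine ⟨b, fun h hh hh' => ?_, p, hb1, hb2⟩
      exact (hb h ⟨hb1.trans hh', hh.trans hb2⟩).not_gt hh
    · rw [Set.disjoint_left]
      rintro a ha ⟨-, ⟨h, h1, h2⟩⟩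
      exact ha h h1 h2
    · exact fun a ha => ha
    · exact fun b hb => hb.1
    · intro e heA _
      by_contra! hcon
      exact heA fun h hh => (hcon h hh).not_gt
    · intro e heA heB
      have heA' : ∃ h, x h < x e ∧ y e < y h := by
        by_contra! hcon
        exact heA fun h hh => (hcon h hh).not_gt
      by_contra! hcon
      exact heB ⟨fun h hh => (hcon h hh).not_gt, heA'⟩
  · push Not at hpq
    obtain ⟨p, q, hne⟩ := exists_pair_ne E
    -- The configuration is an ascending chain, so any split into nonempty parts works.
    refine ⟨{p}ᶜ, {p}, ⟨q, hne.symm⟩, ⟨p, rfl⟩, disjoint_compl_left, ?_, ?_, ?_, ?_⟩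
    · exact fun a _ h hh => (hpq h a hh).not_gt
    · exact fun b _ h hh hh' => (hpq b h hh').not_gt hh
    · exact fun e h h' => absurd h' h
    · exact fun e h h' => absurd h' h

open Classical in
/-- The coordinate `z`, increased by `n` on `S`. -/
noncomputable def shiftOn {E : Type*} (z : E → ℕ) (S : Set E) (n : ℕ) (e : E) : ℕ :=
  if e ∈ S then z e + n else z e

section Shift

variable {E : Type*} {z : E → ℕ} {S : Set E} {n : ℕ}

theorem shiftOn_of_mem {e : E} (he : e ∈ S) : shiftOn z S n e = z e + n := if_pos he

theorem shiftOn_of_notMem {e : E} (he : e ∉ S) : shiftOn z S n e = z e := if_neg he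

theorem le_shiftOn (e : E) : z e ≤ shiftOn z S n e := by
  by_cases he : e ∈ S
  · rw [shiftOn_of_mem he]
    omega
  · rw [shiftOn_of_notMem he]

theorem shiftOn_injective (hz : Function.Injective z) (hn : ∀ e, z e < n) :
    Function.Injective (shiftOn z S n) := by
  intro e f hef
  have he := hn e
  have hf := hn f
  by_cases h1 : e ∈ S <;> by_cases h2 : f ∈ S <;>
    simp only [shiftOn_of_mem, shiftOn_of_notMem, h1, h2, not_false_eq_true] at hef
  · exact hz (by omega)
  · omega
  · omega
  · exact hz hef

theorem shiftOn_lt_of_notMem_of_mem (hn : ∀ e, z e < n) {e f : E} (he : e ∉ S) (hf : f ∈ S) :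
    shiftOn z S n e < shiftOn z S n f := by
  rw [shiftOn_of_notMem he, shiftOn_of_mem hf]
  have := hn e
  omega

end Shift

namespace IsBoundarySplit

variable {E : Type*} {x y : E → ℕ} {A B : Set E} {n : ℕ}

theorem mono_shiftOn (h : IsBoundarySplit x y A B) (hy : Function.Injective y) :
    ∀ a ∈ A, ∀ a' ∈ A, shiftOn x B n a < shiftOn x B n a' →
      shiftOn y A n a < shiftOn y A n a' := by
  intro a ha a' ha' hlt
  rw [shiftOn_of_notMem (h.disjoint.notMem_of_mem_left ha),
    shiftOn_of_notMem (h.disjoint.notMem_of_mem_left ha')] at hlt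
  rw [shiftOn_of_mem ha, shiftOn_of_mem ha']
  have h1 := h.left a' ha' a hlt
  have h2 : y a ≠ y a' := fun h' => by
    rw [hy h'] at hlt
    exact lt_irrefl _ hlt
  omega

theorem isRectangularConfig [Finite E] (h : IsBoundarySplit x y A B)
    (hx : Function.Injective x) (hy : Function.Injective y) (hxn : ∀ e, x e < n)
    (hyn : ∀ e, y e < n) : IsRectangularConfig (shiftOn x B n) (shiftOn y A n) A B where
  nonempty_left := h.nonempty_left
  nonempty_right := h.nonempty_right
  disjoint := h.disjoint
  above _ ha _ he := shiftOn_lt_of_notMem_of_mem hyn he ha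
  right _ hb _ he := shiftOn_lt_of_notMem_of_mem hxn he hb
  mono_left := h.mono_shiftOn hy
  mono_right := h.swap.mono_shiftOn hx
  exists_left e heA heB := by
    obtain ⟨p, hp1, hp2⟩ := h.inner_left e heA heB
    obtain ⟨a, ha, ha', -⟩ := h.exists_left_of_lt hp1 hp2
    refine ⟨a, ha, ?_⟩
    rwa [shiftOn_of_notMem (h.disjoint.notMem_of_mem_left ha), shiftOn_of_notMem heB]
  exists_right e heA heB := by
    obtain ⟨p, hp1, hp2⟩ := h.inner_right e heA heB
    obtain ⟨b, hb, hb', -⟩ := h.swap.exists_left_of_lt hp1 hp2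
    refine ⟨b, hb, ?_⟩
    rwa [shiftOn_of_notMem (h.disjoint.notMem_of_mem_right hb), shiftOn_of_notMem heA]

/-- Both before and after the shift, only points outside `A` and `B` have predecessors, and those
points do not move. -/
theorem leftPred_shiftOn_iff [Finite E] (h : IsBoundarySplit x y A B)
    (hx : Function.Injective x) (hy : Function.Injective y) (hxn : ∀ e, x e < n)
    (hyn : ∀ e, y e < n) (e t : E) :
    LeftPred (shiftOn x B n) (shiftOn y A n) e t ↔ LeftPred x y e t := by
  constructor
  · rintro ⟨h1, h2, h3, s, hs1, hs2⟩
    have htA : t ∉ A := fun htA => by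
      have heA : e ∈ A := by
        by_contra heA
        exact (shiftOn_lt_of_notMem_of_mem hyn heA htA).not_gt h2
      exact h2.not_gt (h.mono_shiftOn hy e heA t htA h1)
    have htB : t ∉ B := fun htB => by
      have hsB : s ∈ B := by
        by_contra hsB
        exact (shiftOn_lt_of_notMem_of_mem hxn hsB htB).not_gt hs1
      exact hs1.not_gt (h.swap.mono_shiftOn hx s hsB t htB hs2)
    have heB : e ∉ B := fun heB => (shiftOn_lt_of_notMem_of_mem hxn htB heB).not_gt h1
    rw [shiftOn_of_notMem htB] at h1
    rw [shiftOn_of_notMem htA] at h2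
    rw [shiftOn_of_notMem heB] at h1
    obtain ⟨p, hp1, hp2⟩ := h.inner_left t htA htB
    obtain ⟨a, ha, ha1, ha2⟩ := h.exists_left_of_lt hp1 hp2
    obtain ⟨q, hq1, hq2⟩ := h.inner_right t htA htB
    refine ⟨h1, ?_, ?_, q, hq2, hq1⟩
    -- The shift hides whether a point of `A` was above `t`. But `a` was, nearness of `e` puts `a`
    -- no further right than `e`, and `A` ascends.
    · by_cases heA : e ∈ A
      · have haB := h.disjoint.notMem_of_mem_left ha
        have hae : x a ≤ x e := by
          by_contra! hcon
          have := h3 a (by rwa [shiftOn_of_notMem heB, shiftOn_of_notMem haB])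
            (by rwa [shiftOn_of_notMem haB, shiftOn_of_notMem htB])
          exact this.not_gt (shiftOn_lt_of_notMem_of_mem hyn htA ha)
        rcases hae.eq_or_lt with heq | hlt
        · rwa [← hx heq]
        · exact ha2.trans_le (not_lt.1 (h.left e heA a hlt))
      · rwa [shiftOn_of_notMem heA] at h2
    · intro g hg1 hg2
      -- A point of `B` has been moved past `t`, so `h3` does not apply to it; being left of `t`
      -- originally, it must lie below `t`, or `t` would be to its lower right.
      by_cases hgB : g ∈ B
      · have hne : y t ≠ y g := fun h' => by
          rw [hy h'] at hg2
          exact lt_irrefl _ hg2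
        have := h.right g hgB t
        omega
      · have := h3 g (by rwa [shiftOn_of_notMem heB, shiftOn_of_notMem hgB])
            (by rwa [shiftOn_of_notMem hgB, shiftOn_of_notMem htB])
        rw [shiftOn_of_notMem htA] at this
        exact (le_shiftOn g).trans_lt this
  · rintro ⟨h1, h2, h3, s, hs1, hs2⟩
    have htA : t ∉ A := fun htA => h.left t htA e h1 h2
    have htB : t ∉ B := fun htB => h.right t htB s hs2 hs1
    have heB : e ∉ B := fun heB => h.right e heB t h2 h1
    have hsA : s ∉ A := fun hsA => h.left s hsA t hs1 hs2
    refine ⟨?_, ?_, ?_, s, ?_, ?_⟩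
    · rwa [shiftOn_of_notMem heB, shiftOn_of_notMem htB]
    · rw [shiftOn_of_notMem htA]
      exact h2.trans_le (le_shiftOn e)
    · intro g hg1 hg2
      have hgB : g ∉ B := fun hgB => (shiftOn_lt_of_notMem_of_mem hxn htB hgB).not_gt hg2
      rw [shiftOn_of_notMem heB, shiftOn_of_notMem hgB] at hg1
      rw [shiftOn_of_notMem hgB, shiftOn_of_notMem htB] at hg2
      have hgt := h3 g hg1 hg2
      have hgA : g ∉ A := fun hgA => h.left g hgA e hg1 (hgt.trans h2)
      rwa [shiftOn_of_notMem hgA, shiftOn_of_notMem htA]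
    · rw [shiftOn_of_notMem htB]
      exact hs1.trans_le (le_shiftOn s)
    · rwa [shiftOn_of_notMem htA, shiftOn_of_notMem hsA]

end IsBoundarySplit

/-- A configuration with at least two points can be made rectangular without changing the
congruence lattice of its quadrant lattice. -/
theorem exists_isSlimRectangularLattice {E : Type*} [Finite E] [Nontrivial E] {x y : E → ℕ}
    (hx : Function.Injective x) (hy : Function.Injective y) :
    ∃ x' y' : E → ℕ, Function.Injective x' ∧ Function.Injective y' ∧
      QuadPred x' y' = QuadPred x y ∧ IsSlimRectangularLattice (QuadLattice x' y') := by
  obtain ⟨A, B, h⟩ := exists_isBoundarySplit x y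
  obtain ⟨n, hn⟩ := (Set.finite_range x).bddAbove
  obtain ⟨m, hm⟩ := (Set.finite_range y).bddAbove
  have hxn : ∀ e, x e < n + m + 1 := fun e => by
    have := hn ⟨e, rfl⟩
    omega
  have hyn : ∀ e, y e < n + m + 1 := fun e => by
    have := hm ⟨e, rfl⟩
    omega
  have hx' := shiftOn_injective (S := B) hx hxn
  have hy' := shiftOn_injective (S := A) hy hyn
  refine ⟨_, _, hx', hy', ?_,
    QuadLattice.isSlimRectangularLattice hx' hy' (h.isRectangularConfig hx hy hxn hyn)⟩
  ext e t
  exact or_congr (h.leftPred_shiftOn_iff hx hy hxn hyn e t)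
    (h.swap.leftPred_shiftOn_iff hy hx hyn hxn e t)

/-! ### Transport along order isomorphisms -/

/-- An order isomorphism restricts to corresponding subtypes. -/
def OrderIso.restrictSubtype {α β : Type*} [LE α] [LE β] (e : α ≃o β) {p : α → Prop}
    {q : β → Prop} (h : ∀ a, p a ↔ q (e a)) : {a // p a} ≃o {b // q b} where
  toEquiv := e.toEquiv.subtypeEquiv h
  map_rel_iff' := e.map_rel_iff

theorem OrderIso.supIrred_apply {α β : Type*} [Lattice α] [Lattice β] (e : α ≃o β) {a : α}
    (ha : SupIrred a) : SupIrred (e a) := by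
  refine ⟨fun h => ha.1 fun b hb => ?_, fun b c hbc => ?_⟩
  · exact e.le_iff_le.1 (h (e.monotone hb))
  · have h : e.symm b ⊔ e.symm c = a := by rw [← map_sup, hbc, e.symm_apply_apply]
    exact (ha.2 h).imp (fun h => by rw [← h, e.apply_symm_apply])
      fun h => by rw [← h, e.apply_symm_apply]

/-- Isomorphic lattices have isomorphic posets of join-irreducible elements. -/
def OrderIso.jirCongr {α β : Type*} [Lattice α] [Lattice β] (e : α ≃o β) :
    JirPoset α ≃o JirPoset β :=
  e.restrictSubtype fun _ => ⟨e.supIrred_apply, fun h => by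
    simpa using e.symm.supIrred_apply h⟩

namespace LatticeCon

variable {L L' : Type*} [Lattice L] [Lattice L']

/-- The preimage of a congruence under a lattice isomorphism. -/
def comapIso (e : L ≃o L') (θ : LatticeCon L') : LatticeCon L where
  r a b := θ.r (e a) (e b)
  iseqv :=
    { refl := fun _ => θ.iseqv.refl _
      symm := fun h => θ.iseqv.symm h
      trans := fun h h' => θ.iseqv.trans h h' }
  inf h h' := by
    rw [map_inf, map_inf]
    exact θ.inf h h'
  sup h h' := by
    rw [map_sup, map_sup]
    exact θ.sup h h'

/-- Isomorphic lattices have isomorphic congruence lattices. -/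
def congrIso (e : L ≃o L') : LatticeCon L ≃o LatticeCon L' where
  toFun := comapIso e.symm
  invFun := comapIso e
  left_inv θ := toSetoid_inj <| Setoid.ext fun a b => by
    change θ.r (e.symm (e a)) (e.symm (e b)) ↔ θ.r a b
    rw [e.symm_apply_apply, e.symm_apply_apply]
  right_inv θ := toSetoid_inj <| Setoid.ext fun a b => by
    change θ.r (e (e.symm a)) (e (e.symm b)) ↔ θ.r a b
    rw [e.apply_symm_apply, e.apply_symm_apply]
  map_rel_iff' {θ θ'} := by
    constructor
    · intro h a b hab
      have := @h (e a) (e b)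
      change θ.r (e.symm (e a)) (e.symm (e b)) → θ'.r (e.symm (e a)) (e.symm (e b)) at this
      rw [e.symm_apply_apply, e.symm_apply_apply] at this
      exact this hab
    · exact fun h a b hab => h hab

end LatticeCon

theorem IsSlimSemimodularLattice.exists_config {L : Type*} [Lattice L]
    (hL : IsSlimSemimodularLattice L) :
    ∃ x y : {m : L // InfIrred m} → ℕ, Function.Injective x ∧ Function.Injective y ∧
      Nonempty (LatticeCon L ≃o ClosedSets (QuadPred x y)) := by
  have := hL.finite
  obtain ⟨x, y, hx, hy, ⟨e⟩⟩ := hL.exists_orderIso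
  exact ⟨x, y, hx, hy, ⟨(LatticeCon.congrIso e).trans (QuadLattice.conOrderIso hx hy)⟩⟩

/-! ### Principal filters -/

section ClosedSets

variable {E : Type*} {R : E → E → Prop}

instance : OrderBot (ClosedSets R) where
  bot := ⟨∅, fun _ _ _ h => h⟩
  bot_le T := Set.empty_subset T.1

/-- The closed sets containing `T₀` correspond to the closed subsets of its complement. -/
def ClosedSets.iciOrderIso (T₀ : ClosedSets R) {R' : {e // e ∉ T₀.1} → {e // e ∉ T₀.1} → Prop}
    (hR : ∀ e t, R' e t ↔ R e.1 t.1) : Set.Ici T₀ ≃o ClosedSets R' where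
  toFun T := ⟨{e | e.1 ∈ T.1.1}, fun e t h he => T.1.2 e.1 t.1 ((hR e t).1 h) he⟩
  invFun S := ⟨⟨T₀.1 ∪ Subtype.val '' S.1, by
    intro e t het he
    by_cases ht : t ∈ T₀.1
    · exact Or.inl ht
    rcases he with he | ⟨f, hf, rfl⟩
    · exact absurd (T₀.2 e t het he) ht
    · exact Or.inr ⟨⟨t, ht⟩, S.2 f ⟨t, ht⟩ ((hR f ⟨t, ht⟩).2 het) hf, rfl⟩⟩,
    Set.subset_union_left⟩
  left_inv T := by
    refine Subtype.ext (Subtype.ext ?_)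
    ext e
    constructor
    · rintro (he | ⟨f, hf, rfl⟩)
      · exact T.2 he
      · exact hf
    · intro he
      by_cases h : e ∈ T₀.1
      · exact Or.inl h
      · exact Or.inr ⟨⟨e, h⟩, he, rfl⟩
  right_inv S := by
    refine Subtype.ext ?_
    ext e
    constructor
    · rintro (he | ⟨f, hf, hfe⟩)
      · exact absurd he e.2
      · exact Subtype.ext hfe ▸ hf
    · exact fun he => Or.inr ⟨e, he, rfl⟩
  map_rel_iff' {T T'} := by
    constructor
    · intro h e he
      by_cases h0 : e ∈ T₀.1
      · exact T'.2 h0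
      · exact h (show (⟨e, h0⟩ : {e // e ∉ T₀.1}) ∈ _ from he)
    · exact fun h e he => h he

/-- At most one point allows only the closed sets `∅` and `E`; this is the source of the bound
three. -/
theorem nontrivial_of_three_le_card [Finite E] (h : 3 ≤ Nat.card (ClosedSets R)) :
    Nontrivial E := by
  classical
  by_contra hE
  rw [not_nontrivial_iff_subsingleton] at hE
  have hinj : Function.Injective fun T : ClosedSets R => decide T.1.Nonempty := by
    intro S T hST
    refine Subtype.ext (Set.ext fun e => ?_)
    have key : ∀ U : ClosedSets R, e ∈ U.1 ↔ U.1.Nonempty :=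
      fun U => ⟨fun h => ⟨e, h⟩, fun ⟨f, hf⟩ => Subsingleton.elim f e ▸ hf⟩
    rw [key, key]
    simpa using hST
  have := Nat.card_le_card_of_injective _ hinj
  rw [Nat.card_eq_fintype_card (α := Bool), Fintype.card_bool] at this
  omega

theorem nontrivial_of_two_le_card_jirPoset (h : 2 ≤ Nat.card (JirPoset (ClosedSets R))) :
    Nontrivial E := by
  -- `Nat.card` is zero on infinite types, so the bound includes finiteness.
  have : Finite (JirPoset (ClosedSets R)) := Nat.finite_of_card_ne_zero (by omega)
  obtain ⟨S, T, hST⟩ := Finite.one_lt_card_iff_nontrivial.1 (Nat.lt_of_succ_le h)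
  by_contra hE
  rw [not_nontrivial_iff_subsingleton] at hE
  have key : ∀ U : JirPoset (ClosedSets R), U.1.1 = Set.univ := by
    intro U
    refine Subsingleton.eq_univ_of_nonempty (Set.nonempty_iff_ne_empty.2 fun h => ?_)
    exact U.2.ne_bot (Subtype.ext h)
  exact hST (Subtype.ext (Subtype.ext ((key S).trans (key T).symm)))

/-- Predecessors of a point outside `T` are outside `T`. Hence deleting `T` keeps the nearest upper
left point of `t`, and the other predecessor of `t` remains as a witness to its lower right. -/
theorem leftPred_restrict_iff [Finite E] {x y : E → ℕ} (hx : Function.Injective x)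
    (hy : Function.Injective y) {T : Set E} (hT : ∀ e t, QuadPred x y e t → e ∈ T → t ∈ T)
    (e t : {e // e ∉ T}) :
    LeftPred (x ∘ Subtype.val) (y ∘ Subtype.val) e t ↔ LeftPred x y e.1 t.1 := by
  constructor
  · rintro ⟨h1, h2, h3, s, hs⟩
    refine ⟨h1, h2, fun g hg1 hg2 => ?_, s.1, hs⟩
    by_contra! hcon
    have hlt : y t.1 < y g := hcon.lt_of_ne fun h => by
      rw [hy h] at hg2
      exact lt_irrefl _ hg2
    obtain ⟨f, hf, hgf⟩ := exists_leftPred hy ⟨hg2, hlt⟩ hs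
    have hfT : f ∉ T := fun h => t.2 (hT f t (Or.inl hf) h)
    exact (h3 ⟨f, hfT⟩ (hg1.trans_le hgf) hf.1).not_gt hf.2.1
  · rintro ⟨h1, h2, h3, s, hs⟩
    refine ⟨h1, h2, fun g hg1 hg2 => h3 g.1 hg1 hg2, ?_⟩
    obtain ⟨f, hf, -⟩ := exists_leftPred hx hs.symm ⟨h2, h1⟩
    exact ⟨⟨f, fun h => t.2 (hT f t (Or.inr hf) h)⟩, hf.2.1, hf.1⟩

theorem quadPred_restrict_iff [Finite E] {x y : E → ℕ} (hx : Function.Injective x)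
    (hy : Function.Injective y) (T : ClosedSets (QuadPred x y)) (e t : {e // e ∉ T.1}) :
    QuadPred (x ∘ Subtype.val) (y ∘ Subtype.val) e t ↔ QuadPred x y e.1 t.1 :=
  or_congr (leftPred_restrict_iff hx hy T.2 e t)
    (leftPred_restrict_iff hy hx (fun e t h => T.2 e t h.symm) e t)

end ClosedSets

/-- Let `d` be the join of the join-irreducibles outside `F`. By distributivity join-irreducibles
are join-prime, so those below `d` are exactly the ones outside `F`, and `p ↦ p ⊔ d` is the required
isomorphism. -/
theorem exists_ici_jirPoset_orderIso {P D : Type*} [PartialOrder P] [DistribLattice D]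
    [OrderBot D] [Finite D] (e : P ≃o JirPoset D) (F : UpperSet P) :
    ∃ d : D, Nonempty (F ≃o JirPoset (Set.Ici d)) := by
  classical
  have : Finite P := Finite.of_equiv _ e.symm.toEquiv
  let := Fintype.ofFinite P
  let d : D := (Finset.univ.filter fun p => p ∉ F).sup fun p => (e p).1
  have hprime : ∀ p, SupPrime (e p).1 := fun p => supPrime_iff_supIrred.2 (e p).2
  have hd : ∀ p, (e p).1 ≤ d ↔ p ∉ F := by
    intro p
    constructor
    · intro h hp
      obtain ⟨q, hq, hpq⟩ := (hprime p).le_finset_sup.1 h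
      exact (Finset.mem_filter.1 hq).2 (F.upper (e.le_iff_le.1 hpq) hp)
    · exact fun h => Finset.le_sup (f := fun p => (e p).1) (by simpa using h)
  have hirr : ∀ p ∈ F, SupIrred (⟨(e p).1 ⊔ d, le_sup_right⟩ : Set.Ici d) := by
    intro p hp
    constructor
    · intro h
      have h1 : (e p).1 ⊔ d ≤ d := h (show (⟨d, le_rfl⟩ : Set.Ici d) ≤ _ from le_sup_right)
      exact (hd p).1 (le_sup_left.trans h1) hp
    · intro a b hab
      have hab' : a.1 ⊔ b.1 = (e p).1 ⊔ d := congrArg Subtype.val hab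
      rcases (hprime p).2 (le_sup_left.trans_eq hab'.symm) with h | h
      · refine Or.inl (Subtype.ext (le_antisymm ?_ (sup_le h a.2)))
        exact le_sup_left.trans_eq hab'
      · refine Or.inr (Subtype.ext (le_antisymm ?_ (sup_le h b.2)))
        exact le_sup_right.trans_eq hab'
  let f : F → JirPoset (Set.Ici d) := fun p => ⟨⟨(e p.1).1 ⊔ d, le_sup_right⟩, hirr p.1 p.2⟩
  have hf : ∀ p q, f p ≤ f q ↔ p ≤ q := by
    intro p q
    constructor
    · intro h
      have h1 : (e p.1).1 ≤ (e q.1).1 ⊔ d := le_sup_left.trans h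
      rcases (hprime p.1).2 h1 with h2 | h2
      · exact e.le_iff_le.1 h2
      · exact absurd p.2 ((hd p.1).1 h2)
    · intro h
      exact sup_le_sup_right (e.monotone h : (e p.1).1 ≤ (e q.1).1) d
  refine ⟨d, ⟨RelIso.ofSurjective (OrderEmbedding.ofMapLEIff f hf) fun s => ?_⟩⟩
  -- Surjectivity: `s` is the join of the elements `j ⊔ d` for `j ∈ S`, hence equal to one of them.
  obtain ⟨S, hS, hS'⟩ := exists_supIrred_decomposition s.1.1
  have hsup : (S.sup fun j => (⟨j ⊔ d, le_sup_right⟩ : Set.Ici d)) = s.1 := by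
    refine le_antisymm (Finset.sup_le fun j hj => ?_) ?_
    · exact sup_le (hS ▸ Finset.le_sup (f := id) hj) s.1.2
    · change s.1.1 ≤ _
      refine hS ▸ Finset.sup_le fun j hj => ?_
      have := Finset.le_sup (f := fun j => (⟨j ⊔ d, le_sup_right⟩ : Set.Ici d)) hj
      exact le_sup_left.trans this
  obtain ⟨j, hj, hjs⟩ := s.2.finset_sup_eq hsup
  obtain ⟨p, hp⟩ := e.surjective ⟨j, hS' hj⟩
  have hpj : (e p).1 = j := congrArg Subtype.val hp
  have hpF : p ∈ F := by
    by_contra hcon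
    have hjd : j ≤ d := hpj ▸ (hd p).2 hcon
    refine s.2.1 fun b _ => ?_
    rw [← hjs]
    exact sup_le (hjd.trans b.2) b.2
  refine ⟨⟨p, hpF⟩, Subtype.ext ?_⟩
  rw [← hjs]
  exact Subtype.ext (congrArg (· ⊔ d) hpj)

theorem Order.PFilter.exists_orderIso_ici {D : Type*} [DistribLattice D] [Finite D]
    (F : Order.PFilter D) : ∃ d : D, Nonempty (F ≃o Set.Ici d) := by
  obtain ⟨d, hd, hmin⟩ := Set.Finite.exists_minimal (s := (F : Set D)) (Set.toFinite _) F.nonempty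
  refine ⟨d, ⟨(OrderIso.refl D).restrictSubtype fun a => ⟨fun ha => ?_, fun ha => ?_⟩⟩⟩
  · exact (hmin (Order.PFilter.inf_mem hd ha) inf_le_left).trans inf_le_right
  · exact Order.PFilter.mem_of_le (show d ≤ a from ha) hd

/-! ### Representability -/

section Representability

variable {E : Type} [Finite E] {x y : E → ℕ}

theorem cspsRepresentable_of_orderIso (hx : Function.Injective x) (hy : Function.Injective y)
    {D : Type*} [DistribLattice D] (e : D ≃o ClosedSets (QuadPred x y)) :
    CSPSRepresentable D ∧ (3 ≤ Nat.card D → CSRRepresentable D) := by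
  refine ⟨⟨QuadLattice x y, inferInstance, QuadLattice.isSlimSemimodularLattice hx hy,
    ⟨e.trans (QuadLattice.conOrderIso hx hy).symm⟩⟩, fun h => ?_⟩
  rw [Nat.card_congr e.toEquiv] at h
  have := nontrivial_of_three_le_card h
  obtain ⟨x', y', hx', hy', hpred, hrect⟩ := exists_isSlimRectangularLattice hx hy
  rw [← hpred] at e
  exact ⟨QuadLattice x' y', inferInstance, hrect,
    ⟨e.trans (QuadLattice.conOrderIso hx' hy').symm⟩⟩

theorem jcspsRepresentable_of_orderIso (hx : Function.Injective x) (hy : Function.Injective y)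
    {P : Type*} [PartialOrder P] (e : P ≃o JirPoset (ClosedSets (QuadPred x y))) :
    JCSPSRepresentable P ∧ (2 ≤ Nat.card P → JCSRRepresentable P) := by
  refine ⟨⟨QuadLattice x y, inferInstance, QuadLattice.isSlimSemimodularLattice hx hy,
    ⟨e.trans (QuadLattice.conOrderIso hx hy).symm.jirCongr⟩⟩, fun h => ?_⟩
  rw [Nat.card_congr e.toEquiv] at h
  have := nontrivial_of_two_le_card_jirPoset h
  obtain ⟨x', y', hx', hy', hpred, hrect⟩ := exists_isSlimRectangularLattice hx hy
  rw [← hpred] at e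
  exact ⟨QuadLattice x' y', inferInstance, hrect,
    ⟨e.trans (QuadLattice.conOrderIso hx' hy').symm.jirCongr⟩⟩

end Representability

theorem JCSPSRepresentable.upperSet {P : Type*} [PartialOrder P] (hP : JCSPSRepresentable P)
    (F : UpperSet P) : JCSPSRepresentable F ∧ (2 ≤ Nat.card F → JCSRRepresentable F) := by
  obtain ⟨L, _, hL, ⟨e⟩⟩ := hP
  have := hL.finite
  obtain ⟨x, y, hx, hy, ⟨c⟩⟩ := hL.exists_config
  obtain ⟨T, ⟨g⟩⟩ := exists_ici_jirPoset_orderIso (e.trans c.jirCongr) F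
  exact jcspsRepresentable_of_orderIso (hx.comp Subtype.val_injective)
    (hy.comp Subtype.val_injective)
    (g.trans (T.iciOrderIso (quadPred_restrict_iff hx hy T)).jirCongr)

theorem CSPSRepresentable.pfilter {D : Type*} [DistribLattice D] [Finite D]
    (hD : CSPSRepresentable D) (F : Order.PFilter D) :
    CSPSRepresentable F ∧ (3 ≤ Nat.card F → CSRRepresentable F) := by
  obtain ⟨L, _, hL, ⟨e⟩⟩ := hD
  have := hL.finite
  obtain ⟨x, y, hx, hy, ⟨c⟩⟩ := hL.exists_config
  obtain ⟨d, ⟨g⟩⟩ := F.exists_orderIso_ici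
  let T : ClosedSets (QuadPred x y) := e.trans c d
  have k : Set.Ici d ≃o Set.Ici T :=
    (e.trans c).restrictSubtype fun a => ((e.trans c).le_iff_le (x := d) (y := a)).symm
  exact cspsRepresentable_of_orderIso (hx.comp Subtype.val_injective)
    (hy.comp Subtype.val_injective)
    ((g.trans k).trans (T.iciOrderIso (quadPred_restrict_iff hx hy T)))

theorem mainTheorem5 :
    (∀ (D : Type*) [DistribLattice D] [Finite D], CSPSRepresentable D →
      ∀ F : Order.PFilter D,
        CSPSRepresentable F ∧ (3 ≤ Nat.card F → CSRRepresentable F)) ∧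
    (∀ (P : Type*) [PartialOrder P] [Finite P],
      (JCSPSRepresentable P → ∀ F : UpperSet P,
        JCSPSRepresentable F ∧ (2 ≤ Nat.card F → JCSRRepresentable F)) ∧
      (JCSRRepresentable P → ∀ F : UpperSet P,
        2 ≤ Nat.card F → JCSRRepresentable F)) :=
  ⟨fun _ _ _ hD F => hD.pfilter F, fun _ _ _ =>
    ⟨fun hP F => hP.upperSet F, fun ⟨L, i, hL, e⟩ F =>
      (JCSPSRepresentable.upperSet ⟨L, i, hL.toIsSlimSemimodularLattice, e⟩ F).2⟩⟩
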